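/- All lattices are finite. An element $x$ of a lattice is reducible if $x=y\vee z$ or $x=y\wedge z$ for some $y,z\neq x$; a block is a lattice whose least element $0$ and greatest element $1$ are reducible. The nullity of a poset is the nullity (edges minus vertices plus connected components) of its cover graph. Let $\mathscr B(j;r,k)$ be the class of blocks on $j$ elements having exactly $r$ reducible elements, these being pairwise comparable, and having nullity $k$. An element $x$ of a poset is retractible if it has exactly one lower cover $y$ and exactly one upper cover $z$ and $x$ is the only element strictly between $y$ and $z$. The basic block associated to a poset is obtained by successively deleting retractible elements until none is left, and then successively deleting all pendant vertices (vertices of degree one of the cover graph). Let $\mathscr B(j;r,k,h)$ be the subclass of those members of $\mathscr B(j;r,k)$ whose associated basic block has height $h$ (number of coverings in a longest chain). For a lattice $L$, elements $a<b$ of $L$ and a chain $K$, let $L]_a^bK$ (the adjunct) be the disjoint union of $L$ and $K$ in which $x\le k$ iff $x\le a$, and $k\le x$ iff $b\le x$, for $x\in L$, $k\in K$. Let $C$ be the chain $0\prec 1\prec\dots\prec 6$, with elements named by these integers, and put $$B_{20}=C]_0^2\{c_1\}]_3^5\{c_2\}]_3^6\{c_3\},\qquad B_{21}=C]_1^3\{c_1\}]_0^3\{c_2\}]_4^6\{c_3\},$$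 $$B_{22}=C]_0^2\{c_1\}]_3^6\{c_2\}]_4^6\{c_3\},\qquad B_{23}=C]_0^2\{c_1\}]_0^3\{c_2\}]_4^6\{c_3\}.$$ For $i\in\{20,21,22,23\}$ let $\mathbb B_i(j;5,3)$ be the class of those members of $\mathscr B(j;5,3)$ whose associated basic block is isomorphic to $B_i$, and let $|\mathbb B_i(j;5,3)|$ be the number of its members up to isomorphism. Let $P_n^k$ be the number of partitions of $n$ into exactly $k$ positive parts. Proposition. Let $j\ge 10$. Then $$|\mathbb B_{20}(j;5,3)|=\sum_{u=4}^{j-6}\ \sum_{r=0}^{u-4}\ \sum_{l=1}^{j-u-5}\ \sum_{s=1}^{j-u-l-4}P^2_{u-r-2}\,P^2_{j-u-l-s-2}.$$ Every $\mathbf B\in\mathbb B_{20}(j;5,3)$, with reducible elements $0<a<b<c<1$, is the linear sum $\mathbf B=\mathbf B'\oplus C'\oplus\mathbf B''$, where $\mathbf B'=[0,a]\in\mathscr B(p;2,1,2)$ with $p\ge4$, $C'=(a,b)$ is a chain with $r\ge0$ elements, $\mathbf B''=[b,1]\in\mathscr B(q;3,2,3)$ with $q\ge6$, and $p+q+r=j$.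 Moreover $|\mathbb B_{21}(j;5,3)|$, $|\mathbb B_{22}(j;5,3)|$ and $|\mathbb B_{23}(j;5,3)|$ are given by the same sum. -/

import Mathlib

namespace RCLattices

universe u v

/-! ### Reducible elements, nullity, blocks -/

/-- `x` is reducible: it is the join, or the meet, of two elements both distinct from `x`. -/
def IsReducible {L : Type u} [Lattice L] (x : L) : Prop :=
  (∃ y z : L, y ≠ x ∧ z ≠ x ∧ y ⊔ z = x) ∨ (∃ y z : L, y ≠ x ∧ z ≠ x ∧ y ⊓ z = x)

/-- The set `Red(L)` of all reducible elements of a lattice. -/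
def Red (L : Type u) [Lattice L] : Set L := {x | IsReducible x}

/-- The nullity of a poset: the nullity (number of edges, minus number of vertices, plus number
of connected components) of its cover graph. -/
noncomputable def nullity (P : Type u) [PartialOrder P] : ℤ :=
  (Nat.card (SimpleGraph.hasse P).edgeSet : ℤ) - (Nat.card P : ℤ)
    + (Nat.card (SimpleGraph.hasse P).ConnectedComponent : ℤ)

/-- A block: a lattice with a least and a greatest element, both of them reducible. -/
def IsBlock (L : Type u) [Lattice L] : Prop :=
  (∃ x : L, IsBot x ∧ IsReducible x) ∧ (∃ x : L, IsTop x ∧ IsReducible x)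

/-- The class `𝓑(j; r, k)`: blocks on `j` elements whose reducible elements are pairwise
comparable and `r` in number, and which have nullity `k`. -/
structure IsBlockOf (j r k : ℕ) (L : Type u) [Lattice L] : Prop where
  finite : Finite L
  card_eq : Nat.card L = j
  block : IsBlock L
  comparable : ∀ x ∈ Red L, ∀ y ∈ Red L, x ≤ y ∨ y ≤ x
  card_red : (Red L).ncard = r
  nullity_eq : nullity L = k

/-! ### The basic block associated to a poset -/

/-- `x` is retractible: it has exactly one lower cover `y` and exactly one upper cover `z`, and
there is no other path from `y` up to `z`.  Deleting `x` then turns `y ⋖ x ⋖ z` into a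
covering `y ⋖ z`, so that the nullity does not change (if there is another path, the deletion
of `x` lowers the nullity by one). -/
def IsRetractible {P : Type u} [PartialOrder P] (x : P) : Prop :=
  ∃ y z : P, (∀ w, w ⋖ x ↔ w = y) ∧ (∀ w, x ⋖ w ↔ w = z) ∧ ∀ w, y < w → w < z → w = x

/-- One step of retraction inside `P`: delete one retractible element of the subposet `S`. -/
def RetractStep {P : Type u} [PartialOrder P] (S T : Set P) : Prop :=
  ∃ x : S, IsRetractible x ∧ T = S \ {(x : P)}

/-- `R` is a basic retract associated to `P`: it is obtained from `P` by successive deletion of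
retractible elements, and no element of `R` is retractible in `R`. -/
def IsBasicRetractOf (P : Type u) [PartialOrder P] (R : Set P) : Prop :=
  Relation.ReflTransGen RetractStep (Set.univ : Set P) R ∧ ∀ x : R, ¬ IsRetractible x

/-- A pendant vertex of a poset: a vertex of degree one of its cover graph. -/
def IsPendant {P : Type u} [PartialOrder P] (x : P) : Prop :=
  ∃! y : P, (SimpleGraph.hasse P).Adj x y

/-- One step of pruning inside `P`: delete one pendant vertex of the subposet `S`. -/
def PendantStep {P : Type u} [PartialOrder P] (S T : Set P) : Prop :=
  ∃ x : S, IsPendant x ∧ T = S \ {(x : P)}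

/-- `S` is a basic block associated to `P`: it is obtained from a basic retract associated to `P`
by successive deletion of all the pendant vertices. -/
def IsBasicBlockOf (P : Type u) [PartialOrder P] (S : Set P) : Prop :=
  ∃ R : Set P, IsBasicRetractOf P R ∧ Relation.ReflTransGen PendantStep R S ∧
    ∀ x : S, ¬ IsPendant x

/-- The class `𝓑(j; r, k, h)`: those members of `𝓑(j; r, k)` whose basic block has height `h`
(the height is the number of coverings in a longest chain). -/
def IsBlockOfHeight (j r k h : ℕ) (L : Type u) [Lattice L] : Prop :=
  IsBlockOf j r k L ∧ ∃ S : Set L, IsBasicBlockOf L S ∧ Order.krullDim S = (h : ℕ)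

/-- The members of `𝓑(j; r, k)` whose basic block is (isomorphic to) `B`. -/
def IsBlockOfType (j r k : ℕ) (B : Type v) [PartialOrder B] (L : Type u) [Lattice L] : Prop :=
  IsBlockOf j r k L ∧ ∃ S : Set L, IsBasicBlockOf L S ∧ Nonempty (S ≃o B)

/-! ### Counting up to isomorphism -/

/-- Isomorphism of lattices, on the lattice structures with underlying set `Fin j` that have a
given property. -/
def isoSetoid (j : ℕ) (p : Lattice (Fin j) → Prop) : Setoid {L : Lattice (Fin j) // p L} where
  r L M := Nonempty (@OrderIso (Fin j) (Fin j) L.1.toLE M.1.toLE)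
  iseqv :=
    { refl := fun L => ⟨@OrderIso.refl (Fin j) L.1.toLE⟩
      symm := fun {L M} ⟨e⟩ => ⟨@OrderIso.symm (Fin j) (Fin j) L.1.toLE M.1.toLE e⟩
      trans := fun {L M N} ⟨e⟩ ⟨f⟩ =>
        ⟨@OrderIso.trans (Fin j) (Fin j) (Fin j) L.1.toLE M.1.toLE N.1.toLE e f⟩ }

/-- The number, up to isomorphism, of members of `𝓑(j; r, k)` whose basic block is `B`. -/
noncomputable def numBlocksOfType (j r k : ℕ) (B : Type v) [PartialOrder B] : ℕ :=
  Nat.card (Quotient (isoSetoid j fun L => @IsBlockOfType j r k B _ (Fin j) L))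

/-- `numPartitions k n` is `P_n^k`, the number of partitions of `n` into exactly `k` (positive,
unordered) parts. -/
noncomputable def numPartitions (k n : ℕ) : ℕ :=
  Nat.card {π : n.Partition // Multiset.card π.parts = k}

/-! ### Adjuncts and the basic blocks `B₂₀`, `B₂₁`, `B₂₂`, `B₂₃` -/

/-- The adjunct of `α` and `β` at the adjunct pair `(a, b)` of `α`: the disjoint union of `α` and
`β`, with `β` placed between `a` and `b`. -/
def Adjunct (α : Type u) (β : Type v) [PartialOrder α] [PartialOrder β] {a b : α} (_h : a < b) :
    Type (max u v) := α ⊕ β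

namespace Adjunct

variable {α : Type u} {β : Type v} [PartialOrder α] [PartialOrder β] {a b : α}

/-- The elements of `α` in the adjunct. -/
def base {h : a < b} (x : α) : Adjunct α β h := Sum.inl x

/-- The order of the adjunct. -/
protected def le (a b : α) : α ⊕ β → α ⊕ β → Prop
  | Sum.inl x, Sum.inl y => x ≤ y
  | Sum.inl x, Sum.inr _ => x ≤ a
  | Sum.inr _, Sum.inl y => b ≤ y
  | Sum.inr u, Sum.inr v => u ≤ v

instance (h : a < b) : PartialOrder (Adjunct α β h) where
  le := Adjunct.le a b
  le_refl x := by cases x <;> simp [Adjunct.le]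
  le_trans x y z hxy hyz := by
    rcases x with x | x <;> rcases y with y | y <;> rcases z with z | z <;>
      simp only [Adjunct.le] at hxy hyz ⊢
    · exact hxy.trans hyz
    · exact hxy.trans hyz
    · exact (hxy.trans h.le).trans hyz
    · exact hxy
    · exact hxy.trans hyz
    · exact absurd (h.trans_le (hxy.trans hyz)) (lt_irrefl _)
    · exact hyz
    · exact hxy.trans hyz
  le_antisymm x y hxy hyx := by
    rcases x with x | x <;> rcases y with y | y <;> simp only [Adjunct.le] at hxy hyx
    · exact congrArg Sum.inl (le_antisymm hxy hyx)
    · exact absurd (h.trans_le (hyx.trans hxy)) (lt_irrefl _)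
    · exact absurd (h.trans_le (hxy.trans hyx)) (lt_irrefl _)
    · exact congrArg Sum.inr (le_antisymm hxy hyx)

theorem base_lt {h : a < b} {x y : α} (hxy : x < y) :
    (base x : Adjunct α β h) < base y :=
  lt_iff_le_not_ge.2 (show x ≤ y ∧ ¬ y ≤ x from lt_iff_le_not_ge.1 hxy)

end Adjunct

/-- The lattice `C ]_{a₁}^{b₁} {c₁} ]_{a₂}^{b₂} {c₂} ]_{a₃}^{b₃} {c₃}`, where `C` is the chain
`0 ⋖ 1 ⋖ ⋯ ⋖ n - 1`. -/
abbrev ChainAdjunct (n : ℕ) {a₁ b₁ a₂ b₂ a₃ b₃ : Fin n} (h₁ : a₁ < b₁) (h₂ : a₂ < b₂)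
    (h₃ : a₃ < b₃) : Type :=
  Adjunct
    (Adjunct (Adjunct (Fin n) (Fin 1) h₁) (Fin 1) (Adjunct.base_lt (h := h₁) h₂))
    (Fin 1) (Adjunct.base_lt (h := Adjunct.base_lt (h := h₁) h₂) (Adjunct.base_lt (h := h₁) h₃))

/-- `B₂₀ = C ]_0^a {c₁} ]_b^c {c₂} ]_b^1 {c₃}` with `C : 0 ⋖ x ⋖ a ⋖ b ⋖ y ⋖ c ⋖ 1`. -/
abbrev B20 : Type :=
  ChainAdjunct 7 (show (0 : Fin 7) < 2 by decide) (show (3 : Fin 7) < 5 by decide)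
    (show (3 : Fin 7) < 6 by decide)

/-- `B₂₁ = C ]_a^b {c₁} ]_0^b {c₂} ]_c^1 {c₃}` with `C : 0 ⋖ a ⋖ x ⋖ b ⋖ c ⋖ y ⋖ 1`. -/
abbrev B21 : Type :=
  ChainAdjunct 7 (show (1 : Fin 7) < 3 by decide) (show (0 : Fin 7) < 3 by decide)
    (show (4 : Fin 7) < 6 by decide)

/-- `B₂₂ = C ]_0^a {c₁} ]_b^1 {c₂} ]_c^1 {c₃}` with `C : 0 ⋖ x ⋖ a ⋖ b ⋖ c ⋖ y ⋖ 1`. -/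
abbrev B22 : Type :=
  ChainAdjunct 7 (show (0 : Fin 7) < 2 by decide) (show (3 : Fin 7) < 6 by decide)
    (show (4 : Fin 7) < 6 by decide)

/-- `B₂₃ = C ]_0^a {c₁} ]_0^b {c₂} ]_c^1 {c₃}` with `C : 0 ⋖ x ⋖ a ⋖ b ⋖ c ⋖ y ⋖ 1`. -/
abbrev B23 : Type :=
  ChainAdjunct 7 (show (0 : Fin 7) < 2 by decide) (show (0 : Fin 7) < 3 by decide)
    (show (4 : Fin 7) < 6 by decide)

/-- The number `∑_{u=4}^{j-6} ∑_{r=0}^{u-4} ∑_{l=1}^{j-u-5} ∑_{s=1}^{j-u-l-4}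
P²_{u-r-2} P²_{j-u-l-s-2}`; for `j ≥ 10` no subtraction in it is truncated. -/
noncomputable def blockSum (j : ℕ) : ℕ :=
  ∑ u ∈ Finset.Icc 4 (j - 6), ∑ r ∈ Finset.Icc 0 (u - 4), ∑ l ∈ Finset.Icc 1 (j - u - 5),
    ∑ s ∈ Finset.Icc 1 (j - u - l - 4),
      numPartitions 2 (u - r - 2) * numPartitions 2 (j - u - l - s - 2)

end RCLattices

open RCLattices

namespace RCLattices

/-! ### Labelled decompositions of posets into a chain of vertices and chains of edge points -/

/-! The idea is to replace membership in a class by the existence of a combinatorial labelling, and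
then to count labellings. A `Shape` is an upward multigraph on a chain of vertices. A `DecompOn`
labels a poset by it: each vertex labels one point, each edge labels a possibly empty chain, and the
order between different labels is that of the multigraph. Each of the four basic blocks is such a
poset with five vertices and seven edges: two pairs of parallel edges, two simple edges, and one
edge that skips a vertex. The simple edges carry no point, every other edge exactly one.

A block has no pendant vertices, and retraction creates none, so its basic block is just its basic
retract. Undoing a retraction inserts a point into a covering, and a covering always lies along a
single edge, so the labelling extends (`DecompOn.exists_insert`). Hence every member of the class
has a decomposition of the given shape in which each non-simple edge carries a point. Conversely, in
a lattice with such a decomposition the reducible elements are exactly the vertices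
(`DecompOn.red_eq`), the nullity is that of the multigraph (`DecompOn.nullity_eq`), and deleting
superfluous edge points leads to a minimal decomposition, which the shape determines up to
isomorphism.

Up to isomorphism a member is therefore given by the seven chain lengths. The vertices are
intrinsic, being the reducible elements, and so is the partition of the remaining points into edge
chains. Only the naming of parallel edges is free, and ordering the lengths within each pair removes
this freedom (`Shape.IsConfig.sizes_unique`). The normalized length vectors are counted by the
quadruple sum (`card_isNormalized`). Nothing but this common edge pattern enters, so the four counts
agree.

For `B20` the second and third vertices are joined by a single simple edge and no edge passes over
this gap. Cutting there yields the linear sum, and the lower and upper parts inherit decompositions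
of smaller shapes. -/

/-- A multigraph on a linearly ordered set of vertices, all of whose edges point upwards. -/
structure Shape (V : Type*) (E : Type*) [LinearOrder V] where
  src : E → V
  tgt : E → V
  lt : ∀ e, src e < tgt e

namespace Shape

variable {V E : Type*} [LinearOrder V] (G : Shape V E)

/-- The order between points of different cells of a decomposition. -/
def le : V ⊕ E → V ⊕ E → Prop
  | Sum.inl u, Sum.inl v => u ≤ v
  | Sum.inl u, Sum.inr e => u ≤ G.src e
  | Sum.inr e, Sum.inl v => G.tgt e ≤ v
  | Sum.inr e, Sum.inr f => G.tgt e ≤ G.src f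

/-- An edge is simple if it joins consecutive vertices and has no parallel edge. -/
def Simple (e : E) : Prop :=
  G.src e ⋖ G.tgt e ∧ ∀ f, G.src f = G.src e → G.tgt f = G.tgt e → f = e

end Shape

/-- `t` labels the points of `S` by vertices and edges of `G`: each vertex labels one point, each
edge labels a chain, and the order between points with different labels is that of `G`. -/
structure DecompOn {P V E : Type*} [PartialOrder P] [LinearOrder V] (G : Shape V E)
    (S : Set P) (t : P → V ⊕ E) : Prop where
  exists_vertex : ∀ v, ∃ p ∈ S, t p = Sum.inl v
  le_iff : ∀ p ∈ S, ∀ q ∈ S, (∀ e, t p = Sum.inr e → t q ≠ Sum.inr e) →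
    (p ≤ q ↔ G.le (t p) (t q))
  total : ∀ p ∈ S, ∀ q ∈ S, ∀ e, t p = Sum.inr e → t q = Sum.inr e → p ≤ q ∨ q ≤ p

/-! ### Order relations read off from labels, and insertion of a point. -/

namespace DecompOn

variable {P V E : Type*} [PartialOrder P] [LinearOrder V] {G : Shape V E} {S : Set P}
  {t : P → V ⊕ E} (D : DecompOn G S t)

include D

/-- The point labelled by a vertex. -/
noncomputable def vert (D : DecompOn G S t) (v : V) : P := (D.exists_vertex v).choose

theorem vert_mem (v : V) : D.vert v ∈ S := (D.exists_vertex v).choose_spec.1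

theorem label_vert (v : V) : t (D.vert v) = Sum.inl v := (D.exists_vertex v).choose_spec.2

theorem vertex_le_vertex {p q : P} (hp : p ∈ S) (hq : q ∈ S) {u v : V} (hu : t p = Sum.inl u)
    (hv : t q = Sum.inl v) : p ≤ q ↔ u ≤ v := by
  rw [D.le_iff p hp q hq (by simp [hu]), hu, hv]; rfl

theorem eq_vert {p : P} (hp : p ∈ S) {v : V} (hv : t p = Sum.inl v) : p = D.vert v :=
  le_antisymm ((D.vertex_le_vertex hp (D.vert_mem v) hv (D.label_vert v)).2 le_rfl)
    ((D.vertex_le_vertex (D.vert_mem v) hp (D.label_vert v) hv).2 le_rfl)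

theorem vert_le_vert {u v : V} : D.vert u ≤ D.vert v ↔ u ≤ v :=
  D.vertex_le_vertex (D.vert_mem u) (D.vert_mem v) (D.label_vert u) (D.label_vert v)

theorem vert_injective : Function.Injective D.vert := fun _ _ h =>
  le_antisymm (D.vert_le_vert.1 h.le) (D.vert_le_vert.1 h.ge)

theorem vert_lt_vert {u v : V} : D.vert u < D.vert v ↔ u < v := by
  rw [lt_iff_le_not_ge, lt_iff_le_not_ge, D.vert_le_vert, D.vert_le_vert]

theorem vert_le_edge {q : P} (hq : q ∈ S) {e : E} (he : t q = Sum.inr e) {u : V} :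
    D.vert u ≤ q ↔ u ≤ G.src e := by
  rw [D.le_iff _ (D.vert_mem u) q hq (by simp [D.label_vert]), he, D.label_vert]; rfl

theorem edge_le_vert {q : P} (hq : q ∈ S) {e : E} (he : t q = Sum.inr e) {u : V} :
    q ≤ D.vert u ↔ G.tgt e ≤ u := by
  rw [D.le_iff q hq _ (D.vert_mem u) (by simp [D.label_vert]), he, D.label_vert]; rfl

theorem edge_le_edge {p q : P} (hp : p ∈ S) (hq : q ∈ S) {e f : E} (he : t p = Sum.inr e)
    (hf : t q = Sum.inr f) (h : e ≠ f) : p ≤ q ↔ G.tgt e ≤ G.src f := by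
  rw [D.le_iff p hp q hq, he, hf]
  · rfl
  · intro g hg hg'
    rw [he] at hg; rw [hf] at hg'
    exact h ((Sum.inr.inj hg).trans (Sum.inr.inj hg').symm)

theorem src_lt {q : P} (hq : q ∈ S) {e : E} (he : t q = Sum.inr e) : D.vert (G.src e) < q :=
  lt_of_le_of_ne ((D.vert_le_edge hq he).2 le_rfl) fun h => by
    have := D.label_vert (G.src e)
    rw [h, he] at this; cases this

theorem lt_tgt {q : P} (hq : q ∈ S) {e : E} (he : t q = Sum.inr e) : q < D.vert (G.tgt e) :=
  lt_of_le_of_ne ((D.edge_le_vert hq he).2 le_rfl) fun h => by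
    have := D.label_vert (G.tgt e)
    rw [← h, he] at this; cases this

/-- A point below a point of an edge is in the same edge or below the source of the edge. -/
theorem label_eq_or_le_src {p q : P} (hp : p ∈ S) (hq : q ∈ S) {e : E} (he : t q = Sum.inr e)
    (h : p ≤ q) : t p = Sum.inr e ∨ p ≤ D.vert (G.src e) := by
  rcases hp' : t p with u | f
  · right
    rw [D.eq_vert hp hp', D.vert_le_vert]
    rwa [D.eq_vert hp hp', D.vert_le_edge hq he] at h
  · by_cases hf : f = e
    · left; rw [hf]
    · right
      rw [D.edge_le_vert hp hp']
      exact (D.edge_le_edge hp hq hp' he hf).1 h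

theorem label_eq_or_tgt_le {p q : P} (hp : p ∈ S) (hq : q ∈ S) {e : E} (he : t q = Sum.inr e)
    (h : q ≤ p) : t p = Sum.inr e ∨ D.vert (G.tgt e) ≤ p := by
  rcases hp' : t p with u | f
  · right
    rw [D.eq_vert hp hp', D.vert_le_vert]
    rwa [D.eq_vert hp hp', D.edge_le_vert hq he] at h
  · by_cases hf : f = e
    · left; rw [hf]
    · right
      rw [D.vert_le_edge hp hp']
      exact (D.edge_le_edge hq hp he hp' (Ne.symm hf)).1 h

/-- The order of a poset with a decomposition, compared with an edge. -/
theorem le_src_iff {p : P} (hp : p ∈ S) {i : E} :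
    p ≤ D.vert (G.src i) ↔ G.le (t p) (Sum.inr i) := by
  rcases hp' : t p with u | f
  · rw [D.eq_vert hp hp', D.vert_le_vert]; rfl
  · rw [D.edge_le_vert hp hp']; rfl

theorem tgt_le_iff {p : P} (hp : p ∈ S) {i : E} :
    D.vert (G.tgt i) ≤ p ↔ G.le (Sum.inr i) (t p) := by
  rcases hp' : t p with u | f
  · rw [D.eq_vert hp hp', D.vert_le_vert]; rfl
  · rw [D.vert_le_edge hp hp']; rfl

theorem le_edge_iff {p q : P} (hp : p ∈ S) (hq : q ∈ S) {i : E} (hi : t p ≠ Sum.inr i)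
    (hqi : t q = Sum.inr i) : p ≤ q ↔ G.le (t p) (Sum.inr i) := by
  rw [← hqi]
  exact D.le_iff p hp q hq fun e he he' => hi (by rw [he, ← he', hqi])

theorem edge_le_iff {p q : P} (hp : p ∈ S) (hq : q ∈ S) {i : E} (hi : t p ≠ Sum.inr i)
    (hqi : t q = Sum.inr i) : q ≤ p ↔ G.le (Sum.inr i) (t p) := by
  rw [← hqi]
  exact D.le_iff q hq p hp fun e he he' => hi (by rw [he', ← he, hqi])

/-- Inserting a point into a covering of a decomposed set. -/
theorem exists_insert [DecidableEq P] (hcov : ∀ u v : V, u ⋖ v → ∃ e, G.src e = u ∧ G.tgt e = v)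
    {T : Set P} {x y z : P} (hS : S = T \ {x}) (hy : y ∈ S) (hz : z ∈ S) (hyx : y < x)
    (hxz : x < z) (hlow : ∀ w ∈ S, w ≤ x → w ≤ y) (hup : ∀ w ∈ S, x ≤ w → z ≤ w)
    (hbet : ∀ w ∈ S, y < w → ¬ w < z) :
    ∃ i, DecompOn G T (Function.update t x (Sum.inr i)) := by
  have hyz := hyx.trans hxz
  -- The covering `y < z` runs along one edge `i`: each end is a point of `i` or the corresponding
  -- end vertex of `i`. If both are vertices they are consecutive, and `hcov` supplies the edge.
  obtain ⟨i, hyi, hzi⟩ : ∃ i, (t y = Sum.inr i ∨ y = D.vert (G.src i)) ∧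
      (t z = Sum.inr i ∨ z = D.vert (G.tgt i)) := by
    rcases hy' : t y with u | e
    · rcases hz' : t z with v | f
      · have hyv := D.eq_vert hy hy'
        have hzv := D.eq_vert hz hz'
        have huv : u < v := by rwa [hyv, hzv, D.vert_lt_vert] at hyz
        obtain ⟨i, hi, hi'⟩ := hcov u v ⟨huv, fun w hw hw' =>
          hbet _ (D.vert_mem w) (hyv ▸ D.vert_lt_vert.2 hw) (hzv ▸ D.vert_lt_vert.2 hw')⟩
        exact ⟨i, Or.inr (hi ▸ hyv), Or.inr (hi' ▸ hzv)⟩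
      · refine ⟨f, Or.inr ?_, Or.inl rfl⟩
        rcases D.label_eq_or_le_src hy hz hz' hyz.le with h | h
        · simp [hy'] at h
        · exact (h.lt_or_eq.resolve_left fun h => hbet _ (D.vert_mem _) h (D.src_lt hz hz'))
    · refine ⟨e, Or.inl rfl, ?_⟩
      rcases D.label_eq_or_tgt_le hz hy hy' hyz.le with h | h
      · exact Or.inl h
      · exact Or.inr
          (h.lt_or_eq.resolve_left fun h => hbet _ (D.vert_mem _) (D.lt_tgt hy hy') h).symm
  have hyi' : ∀ p ∈ S, t p ≠ Sum.inr i → (p ≤ y ↔ G.le (t p) (Sum.inr i)) := by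
    intro p hp hpi
    rcases hyi with h | h
    · exact D.le_edge_iff hp hy hpi h
    · rw [h]; exact D.le_src_iff hp
  have hzi' : ∀ p ∈ S, t p ≠ Sum.inr i → (z ≤ p ↔ G.le (Sum.inr i) (t p)) := by
    intro p hp hpi
    rcases hzi with h | h
    · exact D.edge_le_iff hp hz hpi h
    · rw [h]; exact D.tgt_le_iff hp
  have hlow' : ∀ w ∈ S, (w ≤ x ↔ w ≤ y) := fun w hw => ⟨hlow w hw, fun h => h.trans hyx.le⟩
  have hup' : ∀ w ∈ S, (x ≤ w ↔ z ≤ w) := fun w hw => ⟨hup w hw, fun h => hxz.le.trans h⟩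
  -- A point of edge `i` that is not below `y` lies above `y`, hence by `hbet` not below `z`, hence
  -- above `z`. So the new point is comparable with the whole chain of `i`.
  have hcomp : ∀ w ∈ S, t w = Sum.inr i → w ≤ x ∨ x ≤ w := by
    intro w hw hwi
    by_cases hwy : w ≤ y
    · exact Or.inl (hwy.trans hyx.le)
    · have h1 : y < w := by
        rcases hyi with h | h
        · exact lt_of_le_not_ge ((D.total w hw y hy i hwi h).resolve_left hwy) hwy
        · rw [h]; exact D.src_lt hw hwi
      have h2 := hbet w hw h1
      right
      rcases hzi with h | h
      · rcases D.total w hw z hz i hwi h with h' | h'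
        · rcases h'.lt_or_eq with h' | h'
          · exact absurd h' h2
          · rw [h']; exact hxz.le
        · exact hxz.le.trans h'
      · exact absurd (h ▸ D.lt_tgt hw hwi) h2
  have hT : ∀ p ∈ T, p = x ∨ (p ∈ S ∧ p ≠ x) := by
    intro p hp
    by_cases h : p = x
    · exact Or.inl h
    · exact Or.inr ⟨hS ▸ ⟨hp, h⟩, h⟩
  have hxS : x ∉ S := by rw [hS]; simp
  have hne : ∀ p ∈ S, p ≠ x := fun p hp h => hxS (h ▸ hp)
  refine ⟨i, ?_, ?_, ?_⟩
  · intro v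
    refine ⟨D.vert v, (hS ▸ D.vert_mem v : D.vert v ∈ T \ {x}).1, ?_⟩
    rw [Function.update_of_ne (hne _ (D.vert_mem v)), D.label_vert]
  · intro p hp q hq hpq
    rcases hT p hp with rfl | ⟨hp, hpx⟩ <;> rcases hT q hq with rfl | ⟨hq, hqx⟩
    · simp at hpq
    · rw [Function.update_self, Function.update_of_ne hqx] at *
      rw [hup' q hq, hzi' q hq (hpq i rfl)]
    · rw [Function.update_self, Function.update_of_ne hpx] at *
      rw [hlow' p hp, hyi' p hp fun h => hpq i h rfl]
    · rw [Function.update_of_ne hpx, Function.update_of_ne hqx] at *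
      exact D.le_iff p hp q hq hpq
  · intro p hp q hq e hpe hqe
    rcases hT p hp with rfl | ⟨hp, hpx⟩ <;> rcases hT q hq with rfl | ⟨hq, hqx⟩
    · exact Or.inl le_rfl
    · rw [Function.update_self] at hpe
      rw [Function.update_of_ne hqx] at hqe
      exact (hcomp q hq (hqe.trans hpe.symm)).symm
    · rw [Function.update_self] at hqe
      rw [Function.update_of_ne hpx] at hpe
      exact hcomp p hp (hpe.trans hqe.symm)
    · rw [Function.update_of_ne hpx] at hpe
      rw [Function.update_of_ne hqx] at hqe
      exact D.total p hp q hq e hpe hqe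

end DecompOn

end RCLattices

namespace RCLattices

/-! ### Retractible elements and neighbours in the cover graph -/

/-- Finiteness puts a cover below `x` above anything smaller than `x`, so a unique lower cover is
the greatest element below `x`, and dually. This form mentions only the order and fits the insertion
lemma. -/
theorem isRetractible_iff {P : Type*} [PartialOrder P] [Finite P] {x : P} :
    IsRetractible x ↔ ∃ y z, y < x ∧ x < z ∧ (∀ w, w < x → w ≤ y) ∧ (∀ w, x < w → z ≤ w) ∧
      ∀ w, y < w → w < z → w = x := by
  constructor
  · rintro ⟨y, z, hy, hz, h⟩
    refine ⟨y, z, ((hy y).2 rfl).lt, ((hz z).2 rfl).lt, fun w hw => ?_, fun w hw => ?_, h⟩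
    · obtain ⟨c, hc, hcx⟩ := exists_le_covBy_of_lt hw
      rwa [(hy c).1 hcx] at hc
    · obtain ⟨c, hcx, hc⟩ := exists_covBy_le_of_lt hw
      rwa [(hz c).1 hcx] at hc
  · rintro ⟨y, z, hy, hz, hy', hz', h⟩
    refine ⟨y, z, fun w => ⟨fun hw => ?_, ?_⟩, fun w => ⟨fun hw => ?_, ?_⟩, h⟩
    · by_contra hne
      exact hw.2 (lt_of_le_of_ne (hy' w hw.lt) hne) hy
    · rintro rfl
      exact ⟨hy, fun c hc hcx => hc.not_ge (hy' c hcx)⟩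
    · by_contra hne
      exact hw.2 hz (lt_of_le_of_ne (hz' w hw.lt) (Ne.symm hne))
    · rintro rfl
      exact ⟨hz, fun c hc hcx => hcx.not_ge (hz' c hc)⟩

/-- Every vertex of the cover graph has at least two neighbours. -/
def HasTwoNeighbors (P : Type*) [PartialOrder P] : Prop :=
  ∀ x : P, ∃ a b : P, a ≠ b ∧ (SimpleGraph.hasse P).Adj x a ∧ (SimpleGraph.hasse P).Adj x b

theorem HasTwoNeighbors.not_isPendant {P : Type*} [PartialOrder P] (h : HasTwoNeighbors P)
    (x : P) : ¬ IsPendant x := fun ⟨_, _, hy⟩ => by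
  obtain ⟨a, b, hab, ha, hb⟩ := h x
  exact hab ((hy a ha).trans (hy b hb).symm)

/-- Deleting `x` between its covers `y` and `z` makes `y` and `z` adjacent, which replaces the
neighbour each of them lost. The replacement is new, because `x` had kept `y` and `z` from being
adjacent. No other adjacency is lost. -/
theorem HasTwoNeighbors.of_retractStep {P : Type*} [PartialOrder P] {S T : Set P}
    (h : HasTwoNeighbors S) (hST : RetractStep S T) : HasTwoNeighbors T := by
  obtain ⟨x, ⟨y, z, hy, hz, hyz⟩, rfl⟩ := hST
  have hyx := (hy y).2 rfl
  have hxz := (hz z).2 rfl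
  let f : ∀ a : S, a ≠ x → (S \ {(x : P)} : Set P) := fun a ha =>
    ⟨a, a.2, fun h => ha (Subtype.ext h)⟩
  have hf : ∀ (a b : S) (ha : a ≠ x) (hb : b ≠ x), (SimpleGraph.hasse S).Adj a b →
      (SimpleGraph.hasse (S \ {(x : P)} : Set P)).Adj (f a ha) (f b hb) := by
    intro a b ha hb hab
    rcases hab with hab | hab
    · exact Or.inl ⟨hab.1, fun c hc hc' => hab.2 (c := ⟨c, c.2.1⟩) hc hc'⟩
    · exact Or.inr ⟨hab.1, fun c hc hc' => hab.2 (c := ⟨c, c.2.1⟩) hc hc'⟩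
  have hcov : f y hyx.lt.ne ⋖ f z hxz.lt.ne' :=
    ⟨hyx.lt.trans hxz.lt, fun c hc hc' => c.2.2
      (congrArg Subtype.val (hyz ⟨c, c.2.1⟩ hc hc'))⟩
  have hnyz : ¬ (SimpleGraph.hasse S).Adj y z := by
    rintro (h | h)
    · exact h.2 hyx.lt hxz.lt
    · exact (hyx.lt.trans hxz.lt).not_gt h.lt
  have hadj : ∀ a, (SimpleGraph.hasse S).Adj a x → a = y ∨ a = z := by
    rintro a (h | h)
    · exact Or.inl ((hy a).1 h)
    · exact Or.inr ((hz a).1 h)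
  have key : ∀ (v a b : S) (hv : v ≠ x), a ≠ b → (SimpleGraph.hasse S).Adj v a →
      (SimpleGraph.hasse S).Adj v b → b = x →
      ∃ a b, a ≠ b ∧ (SimpleGraph.hasse (S \ {(x : P)} : Set P)).Adj (f v hv) a ∧
        (SimpleGraph.hasse (S \ {(x : P)} : Set P)).Adj (f v hv) b := by
    rintro v a b hv hab ha hb rfl
    rcases hadj v hb with rfl | rfl
    · refine ⟨f a hab, f z hxz.lt.ne', fun h => ?_, hf v a hv hab ha, Or.inl hcov⟩
      have h : a = z := Subtype.ext (Subtype.ext_iff.1 h :)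
      exact hnyz (h ▸ ha)
    · refine ⟨f a hab, f y hyx.lt.ne, fun h => ?_, hf v a hv hab ha, Or.inr hcov⟩
      have h : a = y := Subtype.ext (Subtype.ext_iff.1 h :)
      exact hnyz (h ▸ ha.symm)
  intro v
  have hvx : (⟨v, v.2.1⟩ : S) ≠ x := fun h => v.2.2 (congrArg Subtype.val h)
  obtain ⟨a, b, hab, ha, hb⟩ := h ⟨v, v.2.1⟩
  by_cases hbx : b = x
  · exact key _ a b hvx hab ha hb hbx
  · by_cases hax : a = x
    · exact key _ b a hvx hab.symm hb ha hax
    · refine ⟨f a hax, f b hbx, fun h => hab ?_, hf _ a hvx hax ha, hf _ b hvx hbx hb⟩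
      exact Subtype.ext (Subtype.ext_iff.1 h :)

theorem HasTwoNeighbors.of_reflTransGen {P : Type*} [PartialOrder P] {S T : Set P}
    (h : HasTwoNeighbors S) (hST : Relation.ReflTransGen RetractStep S T) :
    HasTwoNeighbors T := by
  induction hST with
  | refl => exact h
  | tail _ h2 ih => exact ih.of_retractStep h2

/-- The least element is reducible, hence a meet of two larger elements, and atoms below these must
differ. The greatest element is dual, and any other element has a cover on either side. -/
theorem IsBlock.hasTwoNeighbors {L : Type*} [Lattice L] [Finite L] (h : IsBlock L) :
    HasTwoNeighbors L := by
  obtain ⟨⟨o, ho, hor⟩, ⟨i, hi, hir⟩⟩ := h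
  intro x
  by_cases hxo : x = o
  · subst hxo
    have : ∃ y z, y ≠ x ∧ z ≠ x ∧ y ⊓ z = x := by
      rcases hor with ⟨y, z, hy, hz, h⟩ | h
      · exact absurd (le_antisymm (h ▸ le_sup_left) (ho y)) hy
      · exact h
    obtain ⟨y, z, hy, hz, h⟩ := this
    obtain ⟨a, ha, hay⟩ := exists_covBy_le_of_lt (lt_of_le_of_ne (ho y) hy.symm)
    obtain ⟨b, hb, hbz⟩ := exists_covBy_le_of_lt (lt_of_le_of_ne (ho z) hz.symm)
    refine ⟨a, b, ?_, Or.inl ha, Or.inl hb⟩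
    rintro rfl
    exact ha.lt.not_ge (h ▸ le_inf hay hbz)
  by_cases hxi : x = i
  · subst hxi
    have : ∃ y z, y ≠ x ∧ z ≠ x ∧ y ⊔ z = x := by
      rcases hir with h | ⟨y, z, hy, hz, h⟩
      · exact h
      · exact absurd (le_antisymm (hi y) (h ▸ inf_le_left)) hy
    obtain ⟨y, z, hy, hz, h⟩ := this
    obtain ⟨a, hay, ha⟩ := exists_le_covBy_of_lt (lt_of_le_of_ne (hi y) hy)
    obtain ⟨b, hbz, hb⟩ := exists_le_covBy_of_lt (lt_of_le_of_ne (hi z) hz)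
    refine ⟨a, b, ?_, Or.inr ha, Or.inr hb⟩
    rintro rfl
    exact ha.lt.not_ge (h ▸ sup_le hay hbz)
  obtain ⟨a, ha, -⟩ := exists_covBy_le_of_lt (lt_of_le_of_ne (hi x) hxi)
  obtain ⟨b, -, hb⟩ := exists_le_covBy_of_lt (lt_of_le_of_ne (ho x) (Ne.symm hxo))
  exact ⟨a, b, (hb.lt.trans ha.lt).ne', Or.inl ha, Or.inr hb⟩

theorem HasTwoNeighbors.univ {P : Type*} [PartialOrder P] (h : HasTwoNeighbors P) :
    HasTwoNeighbors (Set.univ : Set P) := by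
  intro x
  obtain ⟨a, b, hab, ha, hb⟩ := h x
  have key : ∀ c, (SimpleGraph.hasse P).Adj x c →
      (SimpleGraph.hasse (Set.univ : Set P)).Adj x ⟨c, trivial⟩ := by
    rintro c (h | h)
    · exact Or.inl ⟨h.1, fun d hd hd' => h.2 (c := d) hd hd'⟩
    · exact Or.inr ⟨h.1, fun d hd hd' => h.2 (c := d) hd hd'⟩
  exact ⟨⟨a, trivial⟩, ⟨b, trivial⟩, fun h => hab (congrArg Subtype.val h), key a ha, key b hb⟩

/-- In a finite block lattice nothing has to be pruned to obtain the basic block. -/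
theorem IsBlock.isBasicBlockOf_iff {L : Type*} [Lattice L] [Finite L] (h : IsBlock L)
    {S : Set L} : IsBasicBlockOf L S ↔ IsBasicRetractOf L S := by
  constructor
  · rintro ⟨R, hR, hRS, -⟩
    have hnp := (h.hasTwoNeighbors.univ.of_reflTransGen hR.1).not_isPendant
    rcases hRS.cases_head with rfl | ⟨T, ⟨x, hx, -⟩, -⟩
    · exact hR
    · exact absurd hx (hnp x)
  · intro hS
    exact ⟨S, hS, Relation.ReflTransGen.refl,
      (h.hasTwoNeighbors.univ.of_reflTransGen hS.1).not_isPendant⟩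

/-! ### Transport and extension of decompositions -/

variable {P V E : Type*} [PartialOrder P] [LinearOrder V] {G : Shape V E} {S : Set P}
  {t : P → V ⊕ E}

/-- Decompositions are pulled back along order embeddings and injections of shapes. -/
theorem DecompOn.pullback (D : DecompOn G S t) {P' V' E' : Type*} [PartialOrder P']
    [LinearOrder V'] {G' : Shape V' E'} {S' : Set P'} {t' : P' → V' ⊕ E'} (g : P' → P)
    (hg : ∀ p ∈ S', ∀ q ∈ S', (g p ≤ g q ↔ p ≤ q)) (hgS : ∀ p ∈ S', g p ∈ S)
    (φ : V' → V) (hφ : StrictMono φ) (ψ : E' → E) (hψ : Function.Injective ψ)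
    (hsrc : ∀ e, G.src (ψ e) = φ (G'.src e)) (htgt : ∀ e, G.tgt (ψ e) = φ (G'.tgt e))
    (hlab : ∀ p ∈ S', t (g p) = Sum.map φ ψ (t' p))
    (hex : ∀ v, ∃ p ∈ S', t' p = Sum.inl v) : DecompOn G' S' t' := by
  have hle : ∀ a b, G.le (Sum.map φ ψ a) (Sum.map φ ψ b) ↔ G'.le a b := by
    rintro (a | a) (b | b) <;> simp [Shape.le, hsrc, htgt, hφ.le_iff_le]
  refine ⟨hex, fun p hp q hq hpq => ?_, fun p hp q hq e hpe hqe => ?_⟩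
  · rw [← hg p hp q hq, ← hle, ← hlab p hp, ← hlab q hq]
    refine D.le_iff _ (hgS p hp) _ (hgS q hq) fun e he he' => ?_
    rw [hlab p hp] at he
    rw [hlab q hq] at he'
    rcases hp' : t' p with u | f
    · simp [hp'] at he
    · rcases hq' : t' q with u | f'
      · simp [hq'] at he'
      · simp only [hp', hq', Sum.map_inr, Sum.inr.injEq] at he he'
        exact hpq f hp' (by rw [hq', hψ (he'.trans he.symm)])
  · rw [← hg p hp q hq, ← hg q hq p hp]
    refine D.total _ (hgS p hp) _ (hgS q hq) (ψ e) ?_ ?_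
    · simp [hlab p hp, hpe]
    · simp [hlab q hq, hqe]

theorem DecompOn.exists_of_retractStep [Finite P] (D : DecompOn G S t)
    (hcov : ∀ u v : V, u ⋖ v → ∃ e, G.src e = u ∧ G.tgt e = v) {T : Set P}
    (h : RetractStep T S) : ∃ t', DecompOn G T t' ∧ ∀ p ∈ S, t' p = t p := by
  classical
  obtain ⟨x, hx, hS⟩ := h
  obtain ⟨y, z, hy, hz, hlow, hup, hbet⟩ := isRetractible_iff.1 hx
  have hmem : ∀ w : T, w ≠ x → (w : P) ∈ S := fun w hw => by
    rw [hS]; exact ⟨w.2, fun h => hw (Subtype.ext h)⟩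
  have hmem' : ∀ w ∈ S, ∃ h : w ∈ T, (⟨w, h⟩ : T) ≠ x := fun w hw => by
    rw [hS] at hw
    exact ⟨hw.1, fun h => hw.2 (congrArg Subtype.val h)⟩
  obtain ⟨i, hi⟩ := D.exists_insert hcov hS (hmem y hy.ne) (hmem z hz.ne') hy hz
    (fun w hw hwx => by
      obtain ⟨h, hne⟩ := hmem' w hw
      exact hlow ⟨w, h⟩ (lt_of_le_of_ne hwx hne))
    (fun w hw hwx => by
      obtain ⟨h, hne⟩ := hmem' w hw
      exact hup ⟨w, h⟩ (lt_of_le_of_ne hwx hne.symm))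
    (fun w hw h1 h2 => by
      obtain ⟨h, hne⟩ := hmem' w hw
      exact hne (hbet ⟨w, h⟩ h1 h2))
  refine ⟨_, hi, fun p hp => Function.update_of_ne ?_ _ _⟩
  rintro rfl
  rw [hS] at hp
  exact hp.2 rfl

/-- The labelling starts on the smallest set and is carried back through the deletions, the last one
first. Labels already assigned are never changed, so fullness is not lost. -/
theorem DecompOn.exists_of_reflTransGen [Finite P] (D : DecompOn G S t)
    (hcov : ∀ u v : V, u ⋖ v → ∃ e, G.src e = u ∧ G.tgt e = v) {T : Set P}
    (h : Relation.ReflTransGen RetractStep T S) :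
    S ⊆ T ∧ ∃ t', DecompOn G T t' ∧ ∀ p ∈ S, t' p = t p := by
  induction h using Relation.ReflTransGen.head_induction_on with
  | refl => exact ⟨subset_rfl, t, D, fun _ _ => rfl⟩
  | head h1 _ ih =>
    obtain ⟨hsub, t', D', ht'⟩ := ih
    obtain ⟨t'', D'', ht''⟩ := D'.exists_of_retractStep hcov h1
    have : ∀ {A B : Set P}, RetractStep A B → B ⊆ A := by
      rintro A B ⟨x, -, rfl⟩
      exact Set.sdiff_subset
    exact ⟨hsub.trans (this h1), t'', D'', fun p hp => (ht'' p (hsub hp)).trans (ht' p hp)⟩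

/-- All edges that are not simple carry a point. -/
def Shape.FullOn (G : Shape V E) (S : Set P) (t : P → V ⊕ E) : Prop :=
  ∀ e, ¬ G.Simple e → ∃ p ∈ S, t p = Sum.inr e

/-- A block whose basic block has a decomposition has one of the same shape. -/
theorem IsBlock.exists_decompOn {L : Type*} [Lattice L] [Finite L] (h : IsBlock L)
    (hcov : ∀ u v : V, u ⋖ v → ∃ e, G.src e = u ∧ G.tgt e = v) (v₀ : V)
    {B : Type*} [PartialOrder B] {tB : B → V ⊕ E} (D : DecompOn G Set.univ tB)
    (hfull : G.FullOn Set.univ tB) {S : Set L} (hS : IsBasicBlockOf L S) (f : S ≃o B) :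
    ∃ t : L → V ⊕ E, DecompOn G Set.univ t ∧ G.FullOn Set.univ t := by
  classical
  have hS' := (h.isBasicBlockOf_iff.1 hS).1
  let t₀ : L → V ⊕ E := fun p => if hp : p ∈ S then tB (f ⟨p, hp⟩) else Sum.inl v₀
  let g : L → B := fun p => if hp : p ∈ S then f ⟨p, hp⟩ else D.vert v₀
  have ht₀ : ∀ b, t₀ (f.symm b) = tB b := fun b => by simp [t₀]
  have D₀ : DecompOn G S t₀ := by
    refine D.pullback g ?_ (fun _ _ => trivial) id strictMono_id id Function.injective_id
      (fun _ => rfl) (fun _ => rfl) ?_ ?_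
    · intro p hp q hq
      simp [g, hp, hq]
    · intro p hp
      simp [g, t₀, hp]
    · intro v
      exact ⟨f.symm (D.vert v), (f.symm (D.vert v)).2, (ht₀ _).trans (D.label_vert v)⟩
  obtain ⟨-, t, Dt, ht⟩ := D₀.exists_of_reflTransGen hcov hS'
  refine ⟨t, Dt, fun e he => ?_⟩
  obtain ⟨p, -, hp⟩ := hfull e he
  exact ⟨f.symm p, trivial, by rw [ht _ (f.symm p).2, ht₀, hp]⟩

end RCLattices

namespace RCLattices

variable {P V E : Type*} [PartialOrder P] [LinearOrder V] {G : Shape V E} {S : Set P}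
  {t : P → V ⊕ E}

/-! ### Minimal decompositions and basic retracts -/

/-- In the parallel case the second edge is itself not simple. In a full decomposition it therefore
carries a point, which is what makes the ends of the first edge branch. -/
theorem Shape.exists_of_not_simple {e : E} (he : ¬ G.Simple e) :
    (∃ u, G.src e < u ∧ u < G.tgt e) ∨
      ∃ f, f ≠ e ∧ G.src f = G.src e ∧ G.tgt f = G.tgt e ∧ ¬ G.Simple f := by
  by_cases h : G.src e ⋖ G.tgt e
  · right
    simp only [Shape.Simple, h, true_and, not_forall] at he
    obtain ⟨f, hs, ht, hf⟩ := he
    exact ⟨f, hf, hs, ht, fun h => hf (h.2 e hs.symm ht.symm).symm⟩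
  · left
    by_contra! h'
    exact h ⟨G.lt e, fun u hu hu' => (h' u hu).not_gt hu'⟩

/-- Between the ends of an edge that is not simple there is something that is not labelled by
this edge. -/
theorem DecompOn.exists_between (D : DecompOn G S t) (hfull : G.FullOn S t) {e : E}
    (he : ¬ G.Simple e) : ∃ z ∈ S, t z ≠ Sum.inr e ∧ D.vert (G.src e) < z ∧
      z < D.vert (G.tgt e) := by
  rcases Shape.exists_of_not_simple he with ⟨u, hu, hu'⟩ | ⟨f, hfe, hs, ht, hf⟩
  · exact ⟨D.vert u, D.vert_mem u, by simp [D.label_vert], D.vert_lt_vert.2 hu,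
      D.vert_lt_vert.2 hu'⟩
  · obtain ⟨z, hz, hzf⟩ := hfull f hf
    refine ⟨z, hz, by simp [hzf, hfe], ?_, ?_⟩
    · rw [← hs]; exact D.src_lt hz hzf
    · rw [← ht]; exact D.lt_tgt hz hzf

/-- Take `y` on the edge and `z` between its ends but off it. A common upper bound below the target
would, being above `y`, lie on the edge; then `z` would lie on the edge or below its source. The
statement avoids joins because it is also applied to subsets of a lattice. -/
theorem DecompOn.exists_join_tgt (D : DecompOn G S t) (hfull : G.FullOn S t) {e : E}
    (he : ¬ G.Simple e) : ∃ y ∈ S, ∃ z ∈ S, y < D.vert (G.tgt e) ∧ z < D.vert (G.tgt e) ∧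
      ∀ m ∈ S, y ≤ m → z ≤ m → ¬ m < D.vert (G.tgt e) := by
  obtain ⟨y, hy, hye⟩ := hfull e he
  obtain ⟨z, hz, hze, hz1, hz2⟩ := D.exists_between hfull he
  refine ⟨y, hy, z, hz, D.lt_tgt hy hye, hz2, fun m hm hym hzm hmt => ?_⟩
  rcases D.label_eq_or_tgt_le hm hy hye hym with h | h
  · rcases D.label_eq_or_le_src hz hm h hzm with h | h
    · exact hze h
    · exact hz1.not_ge h
  · exact hmt.not_ge h

theorem DecompOn.exists_meet_src (D : DecompOn G S t) (hfull : G.FullOn S t) {e : E}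
    (he : ¬ G.Simple e) : ∃ y ∈ S, ∃ z ∈ S, D.vert (G.src e) < y ∧ D.vert (G.src e) < z ∧
      ∀ m ∈ S, m ≤ y → m ≤ z → ¬ D.vert (G.src e) < m := by
  obtain ⟨y, hy, hye⟩ := hfull e he
  obtain ⟨z, hz, hze, hz1, hz2⟩ := D.exists_between hfull he
  refine ⟨y, hy, z, hz, D.src_lt hy hye, hz1, fun m hm hym hzm hmt => ?_⟩
  rcases D.label_eq_or_le_src hm hy hye hym with h | h
  · rcases D.label_eq_or_tgt_le hz hm h hzm with h | h
    · exact hze h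
    · exact hz2.not_ge h
  · exact hmt.not_ge h

/-- What lies strictly between the ends of a simple edge is labelled by the edge. -/
theorem DecompOn.label_of_between (D : DecompOn G S t) {e : E} (he : G.Simple e) {w : P}
    (hw : w ∈ S) (h1 : D.vert (G.src e) < w) (h2 : w < D.vert (G.tgt e)) : t w = Sum.inr e := by
  rcases hl : t w with u | f
  · rw [D.eq_vert hw hl, D.vert_lt_vert] at h1 h2
    exact absurd h2 (he.1.2 h1)
  · have h1 := (D.vert_le_edge hw hl).1 h1.le
    have h2 := (D.edge_le_vert hw hl).1 h2.le
    have h3 : G.src f = G.src e := by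
      by_contra h
      exact he.1.2 (lt_of_le_of_ne h1 (Ne.symm h)) ((G.lt f).trans_le h2)
    have h4 : G.tgt f = G.tgt e := by
      by_contra h
      exact he.1.2 (h1.trans_lt (G.lt f)) (lt_of_le_of_ne h2 h)
    rw [he.2 f h3 h4]

/-- Every edge that is not simple carries exactly one point, and the simple ones carry none. -/
def Shape.MinimalOn (G : Shape V E) (S : Set P) (t : P → V ⊕ E) : Prop :=
  G.FullOn S t ∧ ∀ p ∈ S, ∀ q ∈ S, ∀ e, t p = Sum.inr e → t q = Sum.inr e →
    p = q ∧ ¬ G.Simple e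

/-- Every vertex is an end of an edge that is not simple. -/
def Shape.Branched (G : Shape V E) : Prop :=
  ∀ v, ∃ e, ¬ G.Simple e ∧ (G.src e = v ∨ G.tgt e = v)

theorem DecompOn.exists_greatest [Finite P] (D : DecompOn G S t) (e : E) {A : Set P}
    (hA : ∀ p ∈ A, p ∈ S ∧ t p = Sum.inr e) (hne : A.Nonempty) : ∃ x, IsGreatest A x := by
  obtain ⟨x, hx⟩ := A.toFinite.exists_maximal hne
  refine ⟨x, hx.prop, fun y hy => ?_⟩
  rcases D.total x (hA x hx.prop).1 y (hA y hy).1 e (hA x hx.prop).2 (hA y hy).2 with h | h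
  · exact hx.le_of_ge hy h
  · exact h

theorem DecompOn.exists_least [Finite P] (D : DecompOn G S t) (e : E) {A : Set P}
    (hA : ∀ p ∈ A, p ∈ S ∧ t p = Sum.inr e) (hne : A.Nonempty) : ∃ x, IsLeast A x := by
  obtain ⟨x, hx⟩ := A.toFinite.exists_minimal hne
  refine ⟨x, hx.prop, fun y hy => ?_⟩
  rcases D.total x (hA x hx.prop).1 y (hA y hy).1 e (hA x hx.prop).2 (hA y hy).2 with h | h
  · exact h
  · exact hx.le_of_le hy h

/-- If an edge carries a superfluous point, then it carries a retractible point. -/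
theorem DecompOn.exists_isRetractible [Finite P] (D : DecompOn G S t) {e : E} {p q : P}
    (hp : p ∈ S) (hq : q ∈ S) (hpe : t p = Sum.inr e) (hqe : t q = Sum.inr e)
    (h : p ≠ q ∨ G.Simple e) :
    ∃ x : S, IsRetractible x ∧ t x = Sum.inr e ∧ (p ≠ q → ∃ w ∈ S, w ≠ x ∧ t w = Sum.inr e) := by
  obtain ⟨x, ⟨hx, hxe⟩, hxm⟩ := D.exists_greatest e (A := {w | w ∈ S ∧ t w = Sum.inr e})
    (fun _ h => h) ⟨p, hp, hpe⟩
  have hup : ∀ w : S, x < w → D.vert (G.tgt e) ≤ w := fun w hw => by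
    rcases D.label_eq_or_tgt_le w.2 hx hxe hw.le with h | h
    · exact absurd (hxm ⟨w.2, h⟩) hw.not_ge
    · exact h
  -- With two or more points on the edge, the top one is retractible between the next one and the
  -- target. With a single point the edge must be simple, and that point is retractible between the
  -- two ends.
  by_cases hne : ∃ w, (w ∈ S ∧ t w = Sum.inr e) ∧ w ≠ x
  · obtain ⟨y, ⟨⟨hy, hye⟩, hyx⟩, hym⟩ := D.exists_greatest e
      (A := {w | (w ∈ S ∧ t w = Sum.inr e) ∧ w ≠ x}) (fun _ h => h.1) hne
    refine ⟨⟨x, hx⟩, isRetractible_iff.2 ⟨⟨y, hy⟩, ⟨_, D.vert_mem (G.tgt e)⟩,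
      (lt_of_le_of_ne (hxm ⟨hy, hye⟩) hyx : y < x), D.lt_tgt hx hxe, ?_, hup, ?_⟩, hxe,
      fun _ => ⟨y, hy, hyx, hye⟩⟩
    · intro w hw
      rcases D.label_eq_or_le_src w.2 hx hxe (le_of_lt hw) with h | h
      · exact hym ⟨⟨w.2, h⟩, fun h => hw.ne (Subtype.ext h)⟩
      · exact h.trans (D.src_lt hy hye).le
    · intro w hyw hw
      rcases D.label_eq_or_tgt_le w.2 hy hye (le_of_lt hyw) with h | h
      · by_contra hne
        exact (not_le_of_gt hyw) (hym ⟨⟨w.2, h⟩, fun h => hne (Subtype.ext h)⟩)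
      · exact absurd h (not_le_of_gt hw)
  · push Not at hne
    have hpq : p = q := (hne p ⟨hp, hpe⟩).trans (hne q ⟨hq, hqe⟩).symm
    have hs := h.resolve_left (not_not.2 hpq)
    refine ⟨⟨x, hx⟩, isRetractible_iff.2 ⟨⟨_, D.vert_mem (G.src e)⟩, ⟨_, D.vert_mem (G.tgt e)⟩,
      D.src_lt hx hxe, D.lt_tgt hx hxe, ?_, hup, ?_⟩, hxe, fun h => absurd hpq h⟩
    · intro w hw
      rcases D.label_eq_or_le_src w.2 hx hxe (le_of_lt hw) with h | h
      · exact absurd (Subtype.ext (hne w ⟨w.2, h⟩)) hw.ne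
      · exact h
    · intro w h1 h2
      exact Subtype.ext (hne w ⟨w.2, D.label_of_between hs w.2 h1 h2⟩)

theorem DecompOn.restrict (D : DecompOn G S t) {T : Set P} (hT : T ⊆ S)
    (hv : ∀ v, D.vert v ∈ T) : DecompOn G T t :=
  D.pullback id (fun _ _ _ _ => Iff.rfl) hT id strictMono_id id Function.injective_id
    (fun _ => rfl) (fun _ => rfl) (fun p _ => by simp) fun v => ⟨_, hv v, D.label_vert v⟩

/-- Induction on the number of points: a failure of minimality yields a retractible point on some
edge. If that edge is not simple it keeps another point, so fullness survives the deletion. -/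
theorem DecompOn.exists_minimalOn [Finite P] (D : DecompOn G S t) (hfull : G.FullOn S t) :
    ∃ R, Relation.ReflTransGen RetractStep S R ∧ DecompOn G R t ∧ G.MinimalOn R t := by
  induction hn : S.ncard using Nat.strong_induction_on generalizing S with
  | _ n ih =>
  by_cases hmin : G.MinimalOn S t
  · exact ⟨S, Relation.ReflTransGen.refl, D, hmin⟩
  simp only [Shape.MinimalOn, hfull, true_and] at hmin
  push Not at hmin
  obtain ⟨p, hp, q, hq, e, hpe, hqe, h⟩ := hmin
  have h' : p ≠ q ∨ G.Simple e := by
    by_cases hpq : p = q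
    · exact Or.inr (h hpq)
    · exact Or.inl hpq
  obtain ⟨x, hx, hxe, hw⟩ := D.exists_isRetractible hp hq hpe hqe h'
  have hD : DecompOn G (S \ {(x : P)}) t := D.restrict Set.sdiff_subset fun v =>
    ⟨D.vert_mem v, fun h => by
      have := D.label_vert v
      rw [h, hxe] at this; cases this⟩
  have hF : G.FullOn (S \ {(x : P)}) t := by
    intro f hf
    obtain ⟨w, hwS, hwf⟩ := hfull f hf
    by_cases hwx : w = x
    · have hfe : f = e := by
        rw [hwx, hxe] at hwf
        exact (Sum.inr.inj hwf).symm
      subst hfe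
      obtain ⟨w', hw', hne, hwe⟩ := hw (h'.resolve_right hf)
      exact ⟨w', ⟨hw', hne⟩, hwe⟩
    · exact ⟨w, ⟨hwS, hwx⟩, hwf⟩
  obtain ⟨R, hR, h⟩ := ih _ (hn ▸ Set.ncard_sdiff_singleton_lt_of_mem x.2) hD hF rfl
  exact ⟨R, Relation.ReflTransGen.head ⟨x, hx, rfl⟩ hR, h⟩

/-- At a vertex, some non-simple edge supplies two elements on one side with no bound strictly
between them and the vertex, whereas a retractible point has an extreme element on each side. A
point on an edge is alone there, so its neighbours lie beyond the ends of the edge, and something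
off the edge lies between those ends. -/
theorem DecompOn.not_isRetractible [Finite P] (D : DecompOn G S t) (hG : G.Branched)
    (hmin : G.MinimalOn S t) (x : S) : ¬ IsRetractible x := by
  rw [isRetractible_iff]
  rintro ⟨y, z, hyx, hxz, hy, hz, hyz⟩
  rcases hx : t x with v | e
  · have hxv := D.eq_vert x.2 hx
    obtain ⟨e, he, rfl | rfl⟩ := hG v
    · obtain ⟨a, ha, b, hb, hax, hbx, h⟩ := D.exists_meet_src hmin.1 he
      rw [← hxv] at hax hbx h
      exact h z z.2 (hz ⟨a, ha⟩ hax) (hz ⟨b, hb⟩ hbx) hxz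
    · obtain ⟨a, ha, b, hb, hax, hbx, h⟩ := D.exists_join_tgt hmin.1 he
      rw [← hxv] at hax hbx h
      exact h y y.2 (hy ⟨a, ha⟩ hax) (hy ⟨b, hb⟩ hbx) hyx
  · have he := (hmin.2 x x.2 x x.2 e hx hx).2
    obtain ⟨w, hw, hwe, h1, h2⟩ := D.exists_between hmin.1 he
    have hy' : y ≤ D.vert (G.src e) := by
      rcases D.label_eq_or_le_src y.2 x.2 hx (le_of_lt hyx) with h | h
      · exact absurd (Subtype.ext (hmin.2 y y.2 x x.2 e h hx).1) hyx.ne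
      · exact h
    have hz' : D.vert (G.tgt e) ≤ z := by
      rcases D.label_eq_or_tgt_le z.2 x.2 hx (le_of_lt hxz) with h | h
      · exact absurd (Subtype.ext (hmin.2 x x.2 z z.2 e hx h).1) hxz.ne
      · exact h
    have := hyz ⟨w, hw⟩ (hy'.trans_lt h1) (h2.trans_le hz')
    exact hwe (by rw [show w = x from congrArg Subtype.val this, hx])

/-! ### Decomposed lattices -/

section Lattice

variable {L : Type*} [Lattice L] {t : L → V ⊕ E}

theorem DecompOn.isReducible_vert (D : DecompOn G Set.univ t) (hfull : G.FullOn Set.univ t)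
    (hG : G.Branched) (v : V) : IsReducible (D.vert v) := by
  obtain ⟨e, he, rfl | rfl⟩ := hG v
  · obtain ⟨a, -, b, -, ha, hb, h⟩ := D.exists_meet_src hfull he
    refine Or.inr ⟨a, b, ha.ne', hb.ne', ?_⟩
    by_contra hne
    exact h _ trivial inf_le_left inf_le_right (lt_of_le_of_ne (le_inf ha.le hb.le) (Ne.symm hne))
  · obtain ⟨a, -, b, -, ha, hb, h⟩ := D.exists_join_tgt hfull he
    refine Or.inl ⟨a, b, ha.ne, hb.ne, ?_⟩
    by_contra hne
    exact h _ trivial le_sup_left le_sup_right (lt_of_le_of_ne (sup_le ha.le hb.le) hne)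

/-- Elements below a point of an edge lie on the same edge or below its source. Two incomparable
ones would both lie below the source, and so would their join. The meet is dual. -/
theorem DecompOn.not_isReducible (D : DecompOn G Set.univ t) {p : L} {e : E}
    (hp : t p = Sum.inr e) : ¬ IsReducible p := by
  rintro (⟨y, z, hy, hz, h⟩ | ⟨y, z, hy, hz, h⟩)
  · have hyp : y ≤ p := h ▸ le_sup_left
    have hzp : z ≤ p := h ▸ le_sup_right
    have hyz : ¬ y ≤ z := fun hyz => hz (by rw [← h, sup_eq_right.2 hyz])
    have hzy : ¬ z ≤ y := fun hzy => hy (by rw [← h, sup_eq_left.2 hzy])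
    rcases D.label_eq_or_le_src trivial trivial hp hyp with h1 | h1 <;>
      rcases D.label_eq_or_le_src trivial trivial hp hzp with h2 | h2
    · exact (D.total y trivial z trivial e h1 h2).elim hyz hzy
    · exact hzy (h2.trans (D.src_lt trivial h1).le)
    · exact hyz (h1.trans (D.src_lt trivial h2).le)
    · exact (D.src_lt trivial hp).not_ge (h ▸ sup_le h1 h2)
  · have hyp : p ≤ y := h ▸ inf_le_left
    have hzp : p ≤ z := h ▸ inf_le_right
    have hyz : ¬ y ≤ z := fun hyz => hy (by rw [← h, inf_eq_left.2 hyz])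
    have hzy : ¬ z ≤ y := fun hzy => hz (by rw [← h, inf_eq_right.2 hzy])
    rcases D.label_eq_or_tgt_le trivial trivial hp hyp with h1 | h1 <;>
      rcases D.label_eq_or_tgt_le trivial trivial hp hzp with h2 | h2
    · exact (D.total y trivial z trivial e h1 h2).elim hyz hzy
    · exact hyz ((D.lt_tgt trivial h1).le.trans h2)
    · exact hzy ((D.lt_tgt trivial h2).le.trans h1)
    · exact (D.lt_tgt trivial hp).not_ge (h ▸ le_inf h1 h2)

theorem DecompOn.red_eq (D : DecompOn G Set.univ t) (hfull : G.FullOn Set.univ t)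
    (hG : G.Branched) : Red L = Set.range D.vert := by
  ext p
  constructor
  · intro hp
    rcases h : t p with v | e
    · exact ⟨v, (D.eq_vert trivial h).symm⟩
    · exact absurd hp (D.not_isReducible h)
  · rintro ⟨v, rfl⟩
    exact D.isReducible_vert hfull hG v

end Lattice

theorem DecompOn.isBot_vert (D : DecompOn G Set.univ t) {v : V} (hv : IsBot v) :
    IsBot (D.vert v) := by
  intro p
  rcases h : t p with u | e
  · rw [D.eq_vert trivial h, D.vert_le_vert]; exact hv u
  · rw [D.vert_le_edge trivial h]; exact hv _

theorem DecompOn.isTop_vert (D : DecompOn G Set.univ t) {v : V} (hv : IsTop v) :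
    IsTop (D.vert v) := by
  intro p
  rcases h : t p with u | e
  · rw [D.eq_vert trivial h, D.vert_le_vert]; exact hv u
  · rw [D.edge_le_vert trivial h]; exact hv _

/-! ### The nullity of a decomposed poset -/

theorem card_hasse_edgeSet (P : Type*) [PartialOrder P] :
    Nat.card (SimpleGraph.hasse P).edgeSet = Nat.card {q : P × P // q.1 ⋖ q.2} := by
  symm
  refine Nat.card_congr (Equiv.ofBijective
    (fun q => ⟨s(q.1.1, q.1.2), Or.inl q.2⟩) ⟨?_, ?_⟩)
  · rintro ⟨⟨a, b⟩, h⟩ ⟨⟨c, d⟩, h'⟩ heq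
    rcases Sym2.eq_iff.1 (congrArg Subtype.val heq) with ⟨rfl, rfl⟩ | ⟨rfl, rfl⟩
    · rfl
    · exact absurd h.lt h'.lt.not_gt
  · rintro ⟨q, hq⟩
    induction q using Sym2.ind with
    | _ a b =>
      rcases hq with h | h
      · exact ⟨⟨(a, b), h⟩, rfl⟩
      · exact ⟨⟨(b, a), h⟩, Subtype.ext Sym2.eq_swap⟩

theorem card_hasse_connectedComponent {P : Type*} [PartialOrder P] [Finite P] {o : P}
    (ho : IsBot o) : Nat.card (SimpleGraph.hasse P).ConnectedComponent = 1 := by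
  have hr : ∀ p, (SimpleGraph.hasse P).Reachable o p := by
    intro p
    induction p using WellFoundedLT.induction with
    | _ p ih =>
    by_cases h : o = p
    · rw [h]
    · obtain ⟨c, -, hc⟩ := exists_le_covBy_of_lt (lt_of_le_of_ne (ho p) h)
      exact (ih c hc.lt).trans (SimpleGraph.Adj.reachable (Or.inl hc))
  rw [Nat.card_eq_one_iff_unique]
  refine ⟨⟨?_⟩, ⟨(SimpleGraph.hasse P).connectedComponentMk o⟩⟩
  intro a b
  induction a using SimpleGraph.ConnectedComponent.ind with
  | _ a =>
  induction b using SimpleGraph.ConnectedComponent.ind with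
  | _ b => exact SimpleGraph.ConnectedComponent.sound ((hr a).symm.trans (hr b))

theorem DecompOn.exists_unique_upper_cover [Finite P] (D : DecompOn G Set.univ t) {p : P} {e : E}
    (hp : t p = Sum.inr e) : ∃ s, p ⋖ s ∧ ∀ w, p ⋖ w → w = s := by
  have key : ∀ s, p < s → (∀ w, p < w → s ≤ w) → p ⋖ s ∧ ∀ w, p ⋖ w → w = s :=
    fun s hs h => ⟨⟨hs, fun c hc hcs => hcs.not_ge (h c hc)⟩, fun w hw => by
      by_contra hne
      exact hw.2 hs (lt_of_le_of_ne (h w hw.lt) (Ne.symm hne))⟩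
  by_cases hne : ∃ w, t w = Sum.inr e ∧ p < w
  · obtain ⟨s, ⟨hs, hps⟩, hsm⟩ := D.exists_least e (A := {w | t w = Sum.inr e ∧ p < w})
      (fun _ h => ⟨trivial, h.1⟩) hne
    refine ⟨s, key s hps fun w hw => ?_⟩
    rcases D.label_eq_or_tgt_le trivial trivial hp hw.le with h | h
    · exact hsm ⟨h, hw⟩
    · exact (D.lt_tgt trivial hs).le.trans h
  · refine ⟨D.vert (G.tgt e), key _ (D.lt_tgt trivial hp) fun w hw => ?_⟩
    exact (D.label_eq_or_tgt_le trivial trivial hp hw.le).resolve_left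
      fun h => hne ⟨w, h, hw⟩

theorem DecompOn.exists_first [Finite P] (D : DecompOn G Set.univ t)
    (hfull : G.FullOn Set.univ t) (e : E) : ∃ s, D.vert (G.src e) ⋖ s ∧
      (t s = Sum.inr e ∨ (s = D.vert (G.tgt e) ∧ ∀ w, t w ≠ Sum.inr e)) := by
  by_cases hne : ∃ w, t w = Sum.inr e
  · obtain ⟨s, hs, hsm⟩ := D.exists_least e (A := {w | t w = Sum.inr e})
      (fun _ h => ⟨trivial, h⟩) hne
    refine ⟨s, ⟨D.src_lt trivial hs, fun c hc hcs => ?_⟩, Or.inl hs⟩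
    rcases D.label_eq_or_le_src trivial trivial hs hcs.le with h | h
    · exact hcs.not_ge (hsm h)
    · exact hc.not_ge h
  · push Not at hne
    have he : G.Simple e := by
      by_contra he
      obtain ⟨w, -, hw⟩ := hfull e he
      exact hne w hw
    exact ⟨_, ⟨D.vert_lt_vert.2 (G.lt e), fun c hc hc' =>
      hne c (D.label_of_between he trivial hc hc')⟩, Or.inr ⟨rfl, hne⟩⟩

/-- Coverings are sorted by their lower end. A point of an edge has exactly one upper cover; the
coverings starting at a vertex correspond to the edges leaving it, each edge giving its first point,
or its target if it is empty. -/
theorem DecompOn.card_covBy [Finite P] (D : DecompOn G Set.univ t) (hfull : G.FullOn Set.univ t)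
    (hcov : ∀ u v : V, u ⋖ v → ∃ e, G.src e = u ∧ G.tgt e = v) :
    Nat.card {q : P × P // q.1 ⋖ q.2} = Nat.card ({p // ∃ e, t p = Sum.inr e} ⊕ E) := by
  choose next hnext hnext' using fun p : {p // ∃ e, t p = Sum.inr e} =>
    D.exists_unique_upper_cover p.2.choose_spec
  choose first hfirst hfirst' using D.exists_first hfull
  have hsimple : ∀ e, (∀ w, t w ≠ Sum.inr e) → G.Simple e := fun e h => by
    by_contra he
    obtain ⟨w, -, hw⟩ := hfull e he
    exact h w hw
  symm
  refine Nat.card_congr (Equiv.ofBijective (Sum.elim (fun p => ⟨(p.1, next p), hnext p⟩)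
    (fun e => ⟨(D.vert (G.src e), first e), hfirst e⟩)) ⟨?_, ?_⟩)
  · rintro (p | e) (q | f) h
    · simp only [Sum.elim_inl, Subtype.mk.injEq, Prod.mk.injEq] at h
      exact congrArg Sum.inl (Subtype.ext h.1)
    · simp only [Sum.elim_inl, Sum.elim_inr, Subtype.mk.injEq, Prod.mk.injEq] at h
      obtain ⟨g, hg⟩ := p.2
      rw [h.1, D.label_vert] at hg; cases hg
    · simp only [Sum.elim_inl, Sum.elim_inr, Subtype.mk.injEq, Prod.mk.injEq] at h
      obtain ⟨g, hg⟩ := q.2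
      rw [← h.1, D.label_vert] at hg; cases hg
    · simp only [Sum.elim_inr, Subtype.mk.injEq, Prod.mk.injEq] at h
      have hs := D.vert_injective h.1
      rcases hfirst' e with h1 | ⟨h1, h1'⟩ <;> rcases hfirst' f with h2 | ⟨h2, h2'⟩
      · rw [h.2, h2] at h1
        rw [Sum.inr.inj h1]
      · rw [h.2, h2, D.label_vert] at h1; cases h1
      · rw [← h.2, h1, D.label_vert] at h2; cases h2
      -- Both edges are empty, hence simple by fullness, and they have the same ends, so they
      -- coincide.
      · have ht := D.vert_injective (h1.symm.trans (h.2.trans h2))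
        rw [(hsimple e h1').2 f hs.symm ht.symm]
  · rintro ⟨⟨x, y⟩, hxy⟩
    rcases hx : t x with u | e
    · obtain rfl := D.eq_vert trivial hx
      rcases hy : t y with v | e
      · obtain rfl := D.eq_vert trivial hy
        obtain ⟨e, rfl, rfl⟩ := hcov u v ⟨D.vert_lt_vert.1 hxy.lt, fun w hw hw' =>
          hxy.2 (D.vert_lt_vert.2 hw) (D.vert_lt_vert.2 hw')⟩
        refine ⟨Sum.inr e, ?_⟩
        rcases hfirst' e with h1 | ⟨h1, -⟩
        · exact absurd (D.lt_tgt trivial h1) (hxy.2 (hfirst e).lt)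
        · simp [h1]
      · have hu : u = G.src e := by
          by_contra hne
          exact hxy.2 (D.vert_lt_vert.2 (lt_of_le_of_ne ((D.vert_le_edge trivial hy).1 hxy.le)
            hne)) (D.src_lt trivial hy)
        subst hu
        refine ⟨Sum.inr e, ?_⟩
        have : first e = y := by
          rcases hfirst' e with h1 | ⟨-, h1⟩
          · rcases D.total _ trivial y trivial e h1 hy with h | h
            · by_contra hne
              exact hxy.2 (hfirst e).lt (lt_of_le_of_ne h hne)
            · by_contra hne
              exact (hfirst e).2 hxy.lt (lt_of_le_of_ne h (Ne.symm hne))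
          · exact absurd hy (h1 y)
        simp [this]
    · refine ⟨Sum.inl ⟨x, e, hx⟩, ?_⟩
      simp [hnext' ⟨x, e, hx⟩ y hxy]

theorem DecompOn.card_eq [Finite P] [Finite V] (D : DecompOn G Set.univ t) :
    Nat.card P = Nat.card V + Nat.card {p // ∃ e, t p = Sum.inr e} := by
  rw [← Nat.card_sum]
  symm
  refine Nat.card_congr (Equiv.ofBijective (Sum.elim D.vert Subtype.val) ⟨?_, ?_⟩)
  · refine D.vert_injective.sumElim Subtype.val_injective fun v p h => ?_
    obtain ⟨e, he⟩ := p.2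
    rw [← h, D.label_vert] at he; cases he
  · intro p
    rcases h : t p with v | e
    · exact ⟨Sum.inl v, (D.eq_vert trivial h).symm⟩
    · exact ⟨Sum.inr ⟨p, e, h⟩, rfl⟩

/-- The edge points are counted once among the coverings and once among the elements, so they
cancel; the least vertex makes the cover graph connected. -/
theorem DecompOn.nullity_eq [Finite P] [Finite V] [Nonempty V] [Finite E]
    (D : DecompOn G Set.univ t) (hfull : G.FullOn Set.univ t)
    (hcov : ∀ u v : V, u ⋖ v → ∃ e, G.src e = u ∧ G.tgt e = v) :
    nullity P = Nat.card E - Nat.card V + 1 := by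
  obtain ⟨v, hv⟩ := Finite.exists_min (id : V → V)
  rw [nullity, card_hasse_edgeSet, D.card_covBy hfull hcov, Nat.card_sum,
    card_hasse_connectedComponent (D.isBot_vert (v := v) hv), D.card_eq]
  push_cast
  ring

/-- A lattice with a decomposition belongs to the class determined by the shape. -/
theorem DecompOn.isBlockOf {L : Type*} [Lattice L] [Finite L] [Finite V] [Nonempty V] [Finite E]
    {t : L → V ⊕ E} (D : DecompOn G Set.univ t) (hfull : G.FullOn Set.univ t)
    (hG : G.Branched) (hcov : ∀ u v : V, u ⋖ v → ∃ e, G.src e = u ∧ G.tgt e = v)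
    {j r k : ℕ} (hj : Nat.card L = j) (hr : Nat.card V = r) (hk : Nat.card E + 1 = r + k) :
    IsBlockOf j r k L := by
  obtain ⟨v, hv⟩ := Finite.exists_min (id : V → V)
  obtain ⟨w, hw⟩ := Finite.exists_max (id : V → V)
  refine ⟨inferInstance, hj, ⟨⟨_, D.isBot_vert (v := v) hv, D.isReducible_vert hfull hG v⟩,
    ⟨_, D.isTop_vert (v := w) hw, D.isReducible_vert hfull hG w⟩⟩, ?_, ?_, ?_⟩
  · rw [D.red_eq hfull hG]
    rintro _ ⟨a, rfl⟩ _ ⟨b, rfl⟩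
    rw [D.vert_le_vert, D.vert_le_vert]
    exact le_total a b
  · rw [D.red_eq hfull hG, ← Set.image_univ, Set.ncard_image_of_injective _ D.vert_injective,
      Set.ncard_univ, hr]
  · rw [D.nullity_eq hfull hcov]
    omega

/-- The basic block of a decomposed lattice has a minimal decomposition. -/
theorem DecompOn.exists_isBasicBlockOf {L : Type*} [Lattice L] [Finite L]
    {t : L → V ⊕ E} (D : DecompOn G Set.univ t) (hfull : G.FullOn Set.univ t)
    (hG : G.Branched) (hL : IsBlock L) :
    ∃ R, IsBasicBlockOf L R ∧ DecompOn G R t ∧ G.MinimalOn R t := by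
  obtain ⟨R, hR, DR, hmin⟩ := D.exists_minimalOn hfull
  exact ⟨R, hL.isBasicBlockOf_iff.2 ⟨hR, DR.not_isRetractible hG hmin⟩, DR, hmin⟩

end RCLattices

namespace RCLattices

variable {P V E : Type*} [PartialOrder P] [LinearOrder V] {G : Shape V E} {S : Set P}
  {t : P → V ⊕ E}

/-! ### Model posets -/

/-- The poset of shape `G` whose edges carry chains of prescribed sizes. -/
def Shape.Model (_G : Shape V E) (l : E → ℕ) : Type _ := V ⊕ (Σ e, Fin (l e))

namespace Shape.Model

variable {l : E → ℕ}

/-- The point of the model that belongs to a vertex. -/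
def vertex (v : V) : G.Model l := Sum.inl v

/-- A point of the model that belongs to an edge. -/
def point (e : E) (k : Fin (l e)) : G.Model l := Sum.inr ⟨e, k⟩

/-- The order of the model. -/
protected def le : G.Model l → G.Model l → Prop
  | Sum.inl u, Sum.inl v => u ≤ v
  | Sum.inl u, Sum.inr y => u ≤ G.src y.1
  | Sum.inr x, Sum.inl v => G.tgt x.1 ≤ v
  | Sum.inr x, Sum.inr y => G.tgt x.1 ≤ G.src y.1 ∨ (x.1 = y.1 ∧ (x.2 : ℕ) ≤ y.2)

instance : PartialOrder (G.Model l) where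
  le := Shape.Model.le
  le_refl x := by
    rcases x with x | x
    · exact le_refl x
    · exact Or.inr ⟨rfl, le_rfl⟩
  le_trans x y z hxy hyz := by
    rcases x with u | ⟨e, x⟩ <;> rcases y with v | ⟨f, y⟩ <;> rcases z with w | ⟨g, z⟩ <;>
      simp only [Shape.Model.le] at hxy hyz ⊢
    · exact hxy.trans hyz
    · exact hxy.trans hyz
    · exact (hxy.trans (G.lt f).le).trans hyz
    · rcases hyz with h | ⟨rfl, -⟩
      · exact (hxy.trans (G.lt f).le).trans h
      · exact hxy
    · exact hxy.trans hyz
    · exact Or.inl (hxy.trans hyz)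
    · rcases hxy with h | ⟨rfl, -⟩
      · exact (h.trans (G.lt f).le).trans hyz
      · exact hyz
    · rcases hxy with h | ⟨rfl, h⟩
      · left
        rcases hyz with h' | ⟨rfl, -⟩
        · exact (h.trans (G.lt f).le).trans h'
        · exact h
      · rcases hyz with h' | ⟨rfl, h'⟩
        · exact Or.inl h'
        · exact Or.inr ⟨rfl, h.trans h'⟩
  le_antisymm x y hxy hyx := by
    rcases x with u | ⟨e, x⟩ <;> rcases y with v | ⟨f, y⟩ <;>
      simp only [Shape.Model.le] at hxy hyx
    · exact congrArg Sum.inl (le_antisymm hxy hyx)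
    · exact absurd (hyx.trans hxy) (G.lt f).not_ge
    · exact absurd (hxy.trans hyx) (G.lt e).not_ge
    · have aux : ∀ a b, G.tgt a ≤ G.src b → ¬ G.tgt b ≤ G.src a := fun a b h h' =>
        (G.lt a).not_ge ((h.trans (G.lt b).le).trans h')
      rcases hxy with h | ⟨rfl, h⟩
      · rcases hyx with h' | ⟨rfl, h'⟩
        · exact absurd h' (aux _ _ h)
        · exact absurd h (G.lt f).not_ge
      · rcases hyx with h' | ⟨-, h'⟩
        · exact absurd h' (G.lt e).not_ge
        · rw [Fin.ext (le_antisymm h h')]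

/-- The label of a point of the model. -/
def label : G.Model l → V ⊕ E := Sum.map id Sigma.fst

theorem decompOn (G : Shape V E) (l : E → ℕ) :
    DecompOn G (Set.univ : Set (G.Model l)) label := by
  refine ⟨fun v => ⟨Sum.inl v, trivial, rfl⟩, ?_, ?_⟩
  · rintro (u | ⟨e, x⟩) - (v | ⟨f, y⟩) - h
    · exact Iff.rfl
    · exact Iff.rfl
    · exact Iff.rfl
    · exact or_iff_left fun h' => h e rfl (congrArg Sum.inr h'.1.symm)
  · rintro (u | ⟨e, x⟩) - (v | ⟨f, y⟩) - g hg hg'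
    · cases hg
    · cases hg
    · cases hg'
    · cases hg
      cases hg'
      exact (le_total (x : ℕ) y).imp (fun h => Or.inr ⟨rfl, h⟩) (fun h => Or.inr ⟨rfl, h⟩)

theorem ncard_label (G : Shape V E) (l : E → ℕ) (e : E) :
    {p : G.Model l | label p = Sum.inr e}.ncard = l e := by
  have : {p : G.Model l | label p = Sum.inr e} =
      Set.range (point (G := G) (l := l) e) := by
    ext p
    constructor
    · rcases p with v | ⟨f, k⟩
      · intro h; cases h
      · intro h; cases h; exact ⟨k, rfl⟩
    · rintro ⟨k, rfl⟩; rfl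
  rw [this, ← Set.image_univ, Set.ncard_image_of_injective, Set.ncard_univ, Nat.card_fin]
  intro a b h
  exact eq_of_heq (Sigma.mk.inj (Sum.inr.inj h)).2

end Shape.Model

theorem exists_enumeration {A : Set P} [Finite A] (hA : ∀ p ∈ A, ∀ q ∈ A, p ≤ q ∨ q ≤ p) {n : ℕ}
    (hn : A.ncard = n) :
    ∃ f : Fin n → P, (∀ i k, f i ≤ f k ↔ i ≤ k) ∧ Set.range f = A := by
  classical
  let : LinearOrder A := { (inferInstance : PartialOrder A) with
    le_total := fun p q => hA p p.2 q q.2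
    toDecidableLE := Classical.decRel _ }
  have := Fintype.ofFinite A
  have h : Fintype.card A = n := by rw [← hn, ← Nat.card_eq_fintype_card]; rfl
  let g := monoEquivOfFin A h
  refine ⟨fun i => g i, fun i k => ?_, ?_⟩
  · exact g.le_iff_le
  · ext p
    constructor
    · rintro ⟨i, rfl⟩; exact (g i).2
    · intro hp; exact ⟨g.symm ⟨p, hp⟩, by simp⟩

/-- Different labels are ordered by the shape, and points with one label form a chain determined by
its length. The lengths thus determine the poset. -/
theorem DecompOn.nonempty_orderIso_model [Finite P] (D : DecompOn G S t) {l : E → ℕ}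
    (hl : ∀ e, {p | p ∈ S ∧ t p = Sum.inr e}.ncard = l e) : Nonempty (G.Model l ≃o S) := by
  choose f hf hf' using fun e => exists_enumeration (A := {p | p ∈ S ∧ t p = Sum.inr e})
    (fun p hp q hq => D.total p hp.1 q hq.1 e hp.2 hq.2) (hl e)
  have hfm : ∀ e k, f e k ∈ S ∧ t (f e k) = Sum.inr e := fun e k =>
    (hf' e).subset (Set.mem_range_self k)
  let g : G.Model l → S := Sum.elim (fun v => ⟨D.vert v, D.vert_mem v⟩)
    (fun x => ⟨f x.1 x.2, (hfm x.1 x.2).1⟩)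
  have hg : ∀ a b, g a ≤ g b ↔ a ≤ b := by
    rintro (u | ⟨e, x⟩) (v | ⟨e', y⟩)
    · exact D.vert_le_vert
    · exact D.vert_le_edge (hfm e' y).1 (hfm e' y).2
    · exact D.edge_le_vert (hfm e x).1 (hfm e x).2
    · change f e x ≤ f e' y ↔ G.tgt e ≤ G.src e' ∨ (e = e' ∧ (x : ℕ) ≤ y)
      by_cases h : e = e'
      · subst h
        rw [hf, or_iff_right (G.lt e).not_ge]
        simp
      · rw [D.edge_le_edge (hfm e x).1 (hfm e' y).1 (hfm e x).2 (hfm e' y).2 h]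
        simp [h]
  have hsurj : Function.Surjective g := by
    rintro ⟨p, hp⟩
    rcases h : t p with v | e
    · exact ⟨Sum.inl v, Subtype.ext (D.eq_vert hp h).symm⟩
    · obtain ⟨k, hk⟩ : p ∈ Set.range (f e) := by rw [hf' e]; exact ⟨hp, h⟩
      exact ⟨Sum.inr ⟨e, k⟩, Subtype.ext hk⟩
  have hinj : Function.Injective g := fun a b h =>
    le_antisymm ((hg a b).1 h.le) ((hg b a).1 h.ge)
  exact ⟨⟨Equiv.ofBijective g ⟨hinj, hsurj⟩, fun {a b} => hg a b⟩⟩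

theorem DecompOn.nonempty_orderIso [Finite P] (D : DecompOn G S t) {P' : Type*} [PartialOrder P']
    [Finite P'] {S' : Set P'} {t' : P' → V ⊕ E} (D' : DecompOn G S' t')
    (h : ∀ e, {p | p ∈ S ∧ t p = Sum.inr e}.ncard = {p | p ∈ S' ∧ t' p = Sum.inr e}.ncard) :
    Nonempty (S ≃o S') := by
  obtain ⟨f⟩ := D.nonempty_orderIso_model h
  obtain ⟨g⟩ := D'.nonempty_orderIso_model fun _ => rfl
  exact ⟨f.symm.trans g⟩

omit [PartialOrder P] in
open Classical in
theorem Shape.MinimalOn.ncard (h : G.MinimalOn S t) (e : E) :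
    {p | p ∈ S ∧ t p = Sum.inr e}.ncard = if G.Simple e then 0 else 1 := by
  split_ifs with he
  · rw [← Set.ncard_empty P]
    congr 1
    ext p
    simp only [Set.mem_ofPred_eq, Set.mem_empty_iff_false, iff_false]
    rintro ⟨hp, hpe⟩
    exact (h.2 p hp p hp e hpe hpe).2 he
  · obtain ⟨p, hp, hpe⟩ := h.1 e he
    rw [Set.ncard_eq_one]
    refine ⟨p, ?_⟩
    ext q
    constructor
    · rintro ⟨hq, hqe⟩
      exact (h.2 q hq p hp e hqe hpe).1
    · rintro rfl
      exact ⟨hp, hpe⟩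

/-- Minimal decompositions of the same shape are isomorphic. -/
theorem DecompOn.nonempty_orderIso_of_minimalOn [Finite P] (D : DecompOn G S t)
    (hm : G.MinimalOn S t) {P' : Type*} [PartialOrder P'] [Finite P'] {S' : Set P'}
    {t' : P' → V ⊕ E} (D' : DecompOn G S' t') (hm' : G.MinimalOn S' t') :
    Nonempty (S ≃o S') :=
  D.nonempty_orderIso D' fun e => by rw [hm.ncard, hm'.ncard]

/-! ### Decomposed posets are lattices -/

/-- For incomparable elements, a common upper bound cannot lie on the edge of either one, so it
dominates the least vertex above each. The larger of these two vertices is the join. -/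
theorem DecompOn.exists_isLUB (D : DecompOn G Set.univ t) (x y : P) :
    ∃ s, x ≤ s ∧ y ≤ s ∧ ∀ w, x ≤ w → y ≤ w → s ≤ w := by
  by_cases hxy : x ≤ y
  · exact ⟨y, hxy, le_rfl, fun w _ h => h⟩
  by_cases hyx : y ≤ x
  · exact ⟨x, le_rfl, hyx, fun w h _ => h⟩
  have key : ∀ x y : P, ¬ x ≤ y → ¬ y ≤ x →
      ∃ u, x ≤ D.vert u ∧ ∀ w, x ≤ w → y ≤ w → D.vert u ≤ w := by
    intro x y hxy hyx
    rcases hx : t x with u | e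
    · exact ⟨u, (D.eq_vert trivial hx).le, fun w h _ => D.eq_vert trivial hx ▸ h⟩
    · refine ⟨G.tgt e, (D.lt_tgt trivial hx).le, fun w hxw hyw => ?_⟩
      refine (D.label_eq_or_tgt_le trivial trivial hx hxw).resolve_left fun hw => ?_
      rcases D.label_eq_or_le_src trivial trivial hw hyw with hy | hy
      · exact (D.total x trivial y trivial e hx hy).elim hxy hyx
      · exact hyx (hy.trans (D.src_lt trivial hx).le)
  obtain ⟨u, hxu, hu⟩ := key x y hxy hyx
  obtain ⟨v, hyv, hv⟩ := key y x hyx hxy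
  rcases le_total u v with h | h
  · exact ⟨D.vert v, hxu.trans (D.vert_le_vert.2 h), hyv, fun w h1 h2 => hv w h2 h1⟩
  · exact ⟨D.vert u, hxu, hyv.trans (D.vert_le_vert.2 h), fun w h1 h2 => hu w h1 h2⟩

theorem DecompOn.exists_isGLB (D : DecompOn G Set.univ t) (x y : P) :
    ∃ s, s ≤ x ∧ s ≤ y ∧ ∀ w, w ≤ x → w ≤ y → w ≤ s := by
  by_cases hxy : x ≤ y
  · exact ⟨x, le_rfl, hxy, fun w h _ => h⟩
  by_cases hyx : y ≤ x
  · exact ⟨y, hyx, le_rfl, fun w _ h => h⟩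
  have key : ∀ x y : P, ¬ x ≤ y → ¬ y ≤ x →
      ∃ u, D.vert u ≤ x ∧ ∀ w, w ≤ x → w ≤ y → w ≤ D.vert u := by
    intro x y hxy hyx
    rcases hx : t x with u | e
    · exact ⟨u, (D.eq_vert trivial hx).ge, fun w h _ => D.eq_vert trivial hx ▸ h⟩
    · refine ⟨G.src e, (D.src_lt trivial hx).le, fun w hxw hyw => ?_⟩
      refine (D.label_eq_or_le_src trivial trivial hx hxw).resolve_left fun hw => ?_
      rcases D.label_eq_or_tgt_le trivial trivial hw hyw with hy | hy
      · exact (D.total x trivial y trivial e hx hy).elim hxy hyx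
      · exact hxy ((D.lt_tgt trivial hx).le.trans hy)
  obtain ⟨u, hxu, hu⟩ := key x y hxy hyx
  obtain ⟨v, hyv, hv⟩ := key y x hyx hxy
  rcases le_total u v with h | h
  · exact ⟨D.vert u, hxu, (D.vert_le_vert.2 h).trans hyv, fun w h1 h2 => hu w h1 h2⟩
  · exact ⟨D.vert v, (D.vert_le_vert.2 h).trans hxu, hyv, fun w h1 h2 => hv w h2 h1⟩

/-- Every type in bijection with a model carries a lattice structure of the given shape. -/
theorem Shape.exists_lattice (G : Shape V E) (l : E → ℕ) {X : Type*} (f : X ≃ G.Model l) :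
    ∃ (_ : Lattice X) (t : X → V ⊕ E), DecompOn G Set.univ t ∧
      ∀ e, {p | t p = Sum.inr e}.ncard = l e := by
  have D := Model.decompOn G l
  choose sup h1 h2 h3 using fun x y => D.exists_isLUB (f x) (f y)
  choose inf h4 h5 h6 using fun x y => D.exists_isGLB (f x) (f y)
  let : PartialOrder X := PartialOrder.lift f f.injective
  have hle : ∀ x y : X, x ≤ y ↔ f x ≤ f y := fun _ _ => Iff.rfl
  let : Lattice X :=
    { (inferInstance : PartialOrder X) with
      sup := fun x y => f.symm (sup x y)
      inf := fun x y => f.symm (inf x y)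
      le_sup_left := fun x y => by rw [hle, f.apply_symm_apply]; exact h1 x y
      le_sup_right := fun x y => by rw [hle, f.apply_symm_apply]; exact h2 x y
      sup_le := fun x y z hx hy => by rw [hle, f.apply_symm_apply]; exact h3 x y _ hx hy
      inf_le_left := fun x y => by rw [hle, f.apply_symm_apply]; exact h4 x y
      inf_le_right := fun x y => by rw [hle, f.apply_symm_apply]; exact h5 x y
      le_inf := fun x y z hx hy => by rw [hle, f.apply_symm_apply]; exact h6 y z _ hx hy }
  refine ⟨inferInstance, Model.label ∘ f, ?_, fun e => ?_⟩
  · refine D.pullback f (fun _ _ _ _ => Iff.rfl) (fun _ _ => trivial) id strictMono_id id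
      Function.injective_id (fun _ => rfl) (fun _ => rfl) (fun p _ => by simp) fun v => ?_
    exact ⟨f.symm (Model.vertex v), trivial, by rw [Function.comp_apply, f.apply_symm_apply]; rfl⟩
  · rw [← Model.ncard_label G l e, ← Set.ncard_image_of_injective _ f.injective]
    congr 1
    ext p
    constructor
    · rintro ⟨q, hq, rfl⟩; exact hq
    · intro hp; exact ⟨f.symm p, by simpa using hp, by simp⟩

theorem DecompOn.card_eq_sum [Finite P] [Fintype V] [Fintype E] (D : DecompOn G Set.univ t) :
    Nat.card P = Fintype.card V + ∑ e, {p | t p = Sum.inr e}.ncard := by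
  rw [D.card_eq, Nat.card_eq_fintype_card]
  congr 1
  rw [show (∑ e, {p | t p = Sum.inr e}.ncard) = ∑ e, Nat.card {p // t p = Sum.inr e} from rfl,
    ← Nat.card_sigma]
  refine Nat.card_congr (Equiv.ofBijective
    (fun x => ⟨x.2.1, x.1, x.2.2⟩ : (Σ e, {p // t p = Sum.inr e}) → _) ⟨?_, ?_⟩).symm
  · rintro ⟨e, p, hp⟩ ⟨f, q, hq⟩ h
    obtain rfl : p = q := congrArg Subtype.val h
    obtain rfl : e = f := Sum.inr.inj (hp.symm.trans hq)
    rfl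
  · rintro ⟨p, e, hp⟩
    exact ⟨⟨e, p, hp⟩, rfl⟩

/-! ### Uniqueness of decompositions -/

section Unique

variable {L : Type*} [Lattice L] {t t' : L → V ⊕ E}

/-- Both vertex sets equal the set of reducible elements. Comparing them gives a strictly increasing
self-map of a finite chain, which is the identity. -/
theorem DecompOn.vert_eq [Finite V] (D : DecompOn G Set.univ t) (D' : DecompOn G Set.univ t')
    (hfull : G.FullOn Set.univ t) (hfull' : G.FullOn Set.univ t') (hG : G.Branched) :
    D.vert = D'.vert := by
  have h : ∀ v, ∃ u, D'.vert u = D.vert v := fun v => by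
    have : D.vert v ∈ Red L := D.isReducible_vert hfull hG v
    rwa [D'.red_eq hfull' hG] at this
  choose φ hφ using h
  have hmono : StrictMono φ := fun u v huv => by
    rw [← D'.vert_lt_vert, hφ, hφ, D.vert_lt_vert]; exact huv
  funext v
  rw [← hφ v, le_antisymm (hmono.apply_le (x := v)) (hmono.le_apply (x := v))]

/-- The ends of the edge carrying a point are recovered from its comparisons with the vertices, so
relabelling can only move it to a parallel edge. -/
theorem DecompOn.exists_label (D : DecompOn G Set.univ t) (D' : DecompOn G Set.univ t')
    (hv : D.vert = D'.vert) {p : L} {e : E} (hp : t p = Sum.inr e) :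
    ∃ f, t' p = Sum.inr f ∧ G.src f = G.src e ∧ G.tgt f = G.tgt e := by
  rcases h : t' p with v | f
  · have := D'.eq_vert trivial h
    rw [← hv] at this
    rw [this, D.label_vert] at hp; cases hp
  · refine ⟨f, rfl, ?_, ?_⟩
    · refine le_antisymm ?_ ?_
      · rw [← D.vert_le_edge trivial hp, hv, D'.vert_le_edge trivial h]
      · rw [← D'.vert_le_edge trivial h, ← hv, D.vert_le_edge trivial hp]
    · refine le_antisymm ?_ ?_
      · rw [← D'.edge_le_vert trivial h, ← hv, D.edge_le_vert trivial hp]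
      · rw [← D.edge_le_vert trivial hp, hv, D'.edge_le_vert trivial h]

/-- Points of one edge are comparable, while points of two distinct parallel edges are not, so an
edge chain is never split between parallel edges. -/
theorem DecompOn.label_eq_of_label_eq (D : DecompOn G Set.univ t) (D' : DecompOn G Set.univ t')
    (hv : D.vert = D'.vert) {p q : L} {e f : E} (hp : t p = Sum.inr e) (hp' : t' p = Sum.inr f)
    (hq : t q = Sum.inr e) : t' q = Sum.inr f := by
  obtain ⟨f', hf', hs', ht'⟩ := D.exists_label D' hv hp
  obtain rfl : f = f' := Sum.inr.inj (hp'.symm.trans hf')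
  obtain ⟨g, hg, hs, ht⟩ := D.exists_label D' hv hq
  by_cases h : g = f
  · rw [hg, h]
  · rcases D.total p trivial q trivial e hp hq with hpq | hpq
    · rw [D'.edge_le_edge trivial trivial hp' hg (Ne.symm h), hs, ht'] at hpq
      exact absurd hpq (G.lt e).not_ge
    · rw [D'.edge_le_edge trivial trivial hg hp' h, hs', ht] at hpq
      exact absurd hpq (G.lt e).not_ge

theorem DecompOn.fiber_eq (D : DecompOn G Set.univ t) (D' : DecompOn G Set.univ t')
    (hv : D.vert = D'.vert) {p : L} {e f : E} (hp : t p = Sum.inr e) (hp' : t' p = Sum.inr f) :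
    {q | t q = Sum.inr e} = {q | t' q = Sum.inr f} := by
  ext q
  exact ⟨fun hq => D.label_eq_of_label_eq D' hv hp hp' hq,
    fun hq => D'.label_eq_of_label_eq D hv.symm hp' hp hq⟩

theorem DecompOn.fiber_eq_of_unique (D : DecompOn G Set.univ t) (D' : DecompOn G Set.univ t')
    (hv : D.vert = D'.vert) {e : E}
    (he : ∀ f, G.src f = G.src e → G.tgt f = G.tgt e → f = e) :
    {q | t q = Sum.inr e} = {q | t' q = Sum.inr e} := by
  ext q
  constructor
  · intro hq
    obtain ⟨f, hf, hs, ht⟩ := D.exists_label D' hv hq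
    rwa [he f hs ht] at hf
  · intro hq
    obtain ⟨f, hf, hs, ht⟩ := D'.exists_label D hv.symm hq
    rwa [he f hs ht] at hf

theorem DecompOn.fiber_eq_or_swap (D : DecompOn G Set.univ t) (D' : DecompOn G Set.univ t')
    (hv : D.vert = D'.vert) {a b : E} (hab : a ≠ b)
    (ha : ∀ f, G.src f = G.src a → G.tgt f = G.tgt a → f = a ∨ f = b)
    (hb : ∀ f, G.src f = G.src b → G.tgt f = G.tgt b → f = a ∨ f = b)
    {p q : L} (hp : t p = Sum.inr a) (hq : t q = Sum.inr b) :
    ({x | t x = Sum.inr a} = {x | t' x = Sum.inr a} ∧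
      {x | t x = Sum.inr b} = {x | t' x = Sum.inr b}) ∨
    ({x | t x = Sum.inr a} = {x | t' x = Sum.inr b} ∧
      {x | t x = Sum.inr b} = {x | t' x = Sum.inr a}) := by
  obtain ⟨f, hf, hs, ht⟩ := D.exists_label D' hv hp
  obtain ⟨g, hg, hs', ht'⟩ := D.exists_label D' hv hq
  have hfg : f ≠ g := by
    rintro rfl
    have := D'.label_eq_of_label_eq D hv.symm hf hp hg
    rw [hq] at this
    exact hab (Sum.inr.inj this).symm
  have h1 := D.fiber_eq D' hv hp hf
  have h2 := D.fiber_eq D' hv hq hg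
  rcases ha f hs ht with rfl | rfl <;> rcases hb g hs' ht' with rfl | rfl
  · exact absurd rfl hfg
  · exact Or.inl ⟨h1, h2⟩
  · exact Or.inr ⟨h1, h2⟩
  · exact absurd rfl hfg

end Unique

end RCLattices

namespace RCLattices

/-! ### Partitions into two parts -/

/-- The smaller part determines the partition and ranges over `1, …, n / 2`. -/
theorem numPartitions_two (n : ℕ) : numPartitions 2 n = n / 2 := by
  have : numPartitions 2 n = Nat.card (Finset.Icc 1 (n / 2)) := by
    symm
    refine Nat.card_congr (Equiv.ofBijective (fun m => ⟨⟨{m.1, n - m.1}, ?_, ?_⟩, ?_⟩) ⟨?_, ?_⟩)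
    · obtain ⟨m, hm⟩ := m
      rw [Finset.mem_Icc] at hm
      intro i hi
      simp only [Multiset.insert_eq_cons, Multiset.mem_cons, Multiset.mem_singleton] at hi
      omega
    · obtain ⟨m, hm⟩ := m
      rw [Finset.mem_Icc] at hm
      simp only [Multiset.insert_eq_cons, Multiset.sum_cons, Multiset.sum_singleton]
      omega
    · simp
    · rintro ⟨a, ha⟩ ⟨b, hb⟩ h
      rw [Finset.mem_Icc] at ha hb
      have h : ({a, n - a} : Multiset ℕ) = {b, n - b} :=
        congrArg (fun x => x.1.parts) h
      have h1 : a ∈ ({b, n - b} : Multiset ℕ) := by rw [← h]; simp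
      simp only [Multiset.insert_eq_cons, Multiset.mem_cons, Multiset.mem_singleton] at h1
      apply Subtype.ext
      change a = b
      have h2 : b ∈ ({a, n - a} : Multiset ℕ) := by rw [h]; simp
      simp only [Multiset.insert_eq_cons, Multiset.mem_cons, Multiset.mem_singleton] at h2
      omega
    · rintro ⟨π, hπ⟩
      obtain ⟨a, b, hab⟩ := Multiset.card_eq_two.1 hπ
      have ha : 0 < a := π.parts_pos (by rw [hab]; simp)
      have hb : 0 < b := π.parts_pos (by rw [hab]; simp)
      have hs : a + b = n := by
        have := π.parts_sum
        rw [hab] at this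
        simpa using this
      rcases le_total a b with h | h
      · refine ⟨⟨a, Finset.mem_Icc.2 ⟨ha, by omega⟩⟩, Subtype.ext (Nat.Partition.ext ?_)⟩
        change ({a, n - a} : Multiset ℕ) = π.parts
        rw [hab, show n - a = b by omega]
      · refine ⟨⟨b, Finset.mem_Icc.2 ⟨hb, by omega⟩⟩, Subtype.ext (Nat.Partition.ext ?_)⟩
        change ({b, n - b} : Multiset ℕ) = π.parts
        rw [hab, show n - b = a by omega, Multiset.pair_comm]
  rw [this, Nat.card_eq_fintype_card, Fintype.card_coe]
  simp

/-! ### Counting normalized sizes -/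

/-- Sizes of the edges of a block on `j` elements with two pairs `{0, 1}`, `{2, 3}` of parallel
edges, two simple edges `4`, `5` and one further edge `6`; the sizes in a pair are ordered. -/
structure IsNormalized (j : ℕ) (l : Fin 7 → ℕ) : Prop where
  pos_zero : 1 ≤ l 0
  zero_le_one : l 0 ≤ l 1
  pos_two : 1 ≤ l 2
  two_le_three : l 2 ≤ l 3
  pos_six : 1 ≤ l 6
  sum_eq : 5 + ∑ e, l e = j

/-- The index set of the sum `blockSum`, with partitions into two parts replaced by their
smaller parts. -/
def blockIndex (j : ℕ) : Finset (Σ _ : ℕ, Σ _ : ℕ, Σ _ : ℕ, Σ _ : ℕ, ℕ × ℕ) :=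
  (Finset.Icc 4 (j - 6)).sigma fun u => (Finset.Icc 0 (u - 4)).sigma fun r =>
    (Finset.Icc 1 (j - u - 5)).sigma fun l => (Finset.Icc 1 (j - u - l - 4)).sigma fun s =>
      Finset.Icc 1 ((u - r - 2) / 2) ×ˢ Finset.Icc 1 ((j - u - l - s - 2) / 2)

theorem card_blockIndex (j : ℕ) : (blockIndex j).card = blockSum j := by
  simp [blockIndex, blockSum, Finset.card_sigma, Finset.card_product, numPartitions_two]

theorem mem_blockIndex {j u r l s m n : ℕ} :
    (⟨u, r, l, s, m, n⟩ : Σ _ : ℕ, Σ _ : ℕ, Σ _ : ℕ, Σ _ : ℕ, ℕ × ℕ) ∈ blockIndex j ↔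
      (4 ≤ u ∧ u ≤ j - 6) ∧ r ≤ u - 4 ∧ (1 ≤ l ∧ l ≤ j - u - 5) ∧
        (1 ≤ s ∧ s ≤ j - u - l - 4) ∧ (1 ≤ m ∧ m ≤ (u - r - 2) / 2) ∧
          1 ≤ n ∧ n ≤ (j - u - l - s - 2) / 2 := by
  simp [blockIndex]

/-- The dictionary is `u = l 0 + l 1 + l 4 + 2`, `r = l 4`, `s = l 6`, and the summation index
called `l` is `l 5 + 1`, since it starts at one while a simple edge may be empty. The two partitions
are `l 0 + l 1` and `l 2 + l 3`, recorded by their smaller parts. -/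
theorem card_isNormalized {j : ℕ} (hj : 10 ≤ j) :
    Nat.card {l : Fin 7 → ℕ // IsNormalized j l} = blockSum j := by
  rw [← card_blockIndex, ← Fintype.card_coe, ← Nat.card_eq_fintype_card]
  symm
  refine Nat.card_congr (Equiv.ofBijective (fun x => ⟨![x.1.2.2.2.2.1,
    x.1.1 - x.1.2.1 - 2 - x.1.2.2.2.2.1, x.1.2.2.2.2.2,
    j - x.1.1 - x.1.2.2.1 - x.1.2.2.2.1 - 2 - x.1.2.2.2.2.2, x.1.2.1, x.1.2.2.1 - 1,
    x.1.2.2.2.1], ?_⟩) ⟨?_, ?_⟩)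
  · obtain ⟨⟨u, r, l, s, m, n⟩, hx⟩ := x
    rw [mem_blockIndex] at hx
    constructor <;> simp [Fin.sum_univ_seven] <;> omega
  · rintro ⟨⟨u, r, l, s, m, n⟩, hx⟩ ⟨⟨u', r', l', s', m', n'⟩, hx'⟩ h
    rw [mem_blockIndex] at hx hx'
    have h := congrArg Subtype.val h
    have h0 : m = m' := congrFun h 0
    have h1 : u - r - 2 - m = u' - r' - 2 - m' := congrFun h 1
    have h2 : n = n' := congrFun h 2
    have h4 : r = r' := congrFun h 4
    have h5 : l - 1 = l' - 1 := congrFun h 5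
    have h6 : s = s' := congrFun h 6
    obtain rfl : u = u' := by omega
    obtain rfl : l = l' := by omega
    subst h0 h2 h4 h6
    rfl
  · rintro ⟨l, h⟩
    have hs := h.sum_eq
    rw [Fin.sum_univ_seven] at hs
    obtain ⟨h0, h01, h2, h23, h6, -⟩ := h
    refine ⟨⟨⟨l 0 + l 1 + l 4 + 2, l 4, l 5 + 1, l 6, l 0, l 2⟩, ?_⟩, Subtype.ext ?_⟩
    · rw [mem_blockIndex]
      omega
    · funext e
      fin_cases e <;> simp <;> omega

/-! ### Counting blocks -/

/-- The shapes on five vertices in which exactly `4` and `5` are simple edges, and `{0, 1}`,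
`{2, 3}` are the pairs of parallel edges. -/
structure Shape.IsConfig (G : Shape (Fin 5) (Fin 7)) : Prop where
  simple_iff : ∀ e, G.Simple e ↔ e = 4 ∨ e = 5
  branched : G.Branched
  covers : ∀ u v, u ⋖ v → ∃ e, G.src e = u ∧ G.tgt e = v
  parallel : ∀ e f, G.src f = G.src e → G.tgt f = G.tgt e →
    f = e ∨ (e = 0 ∧ f = 1) ∨ (e = 1 ∧ f = 0) ∨ (e = 2 ∧ f = 3) ∨ (e = 3 ∧ f = 2)
  src_zero : G.src 0 = G.src 1
  tgt_zero : G.tgt 0 = G.tgt 1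
  src_two : G.src 2 = G.src 3
  tgt_two : G.tgt 2 = G.tgt 3

/-- `P` has a decomposition of shape `G` with edges of sizes `l`. -/
def Shape.HasSizes {V E : Type*} [LinearOrder V] (G : Shape V E) (l : E → ℕ) (P : Type*)
    [PartialOrder P] : Prop :=
  ∃ t : P → V ⊕ E, DecompOn G Set.univ t ∧ ∀ e, {p | t p = Sum.inr e}.ncard = l e

section HasSizes

variable {V E : Type*} [LinearOrder V] {G : Shape V E} {l : E → ℕ}

theorem Shape.HasSizes.of_orderIso {P Q : Type*} [PartialOrder P] [PartialOrder Q]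
    (h : G.HasSizes l P) (f : Q ≃o P) : G.HasSizes l Q := by
  obtain ⟨t, D, hl⟩ := h
  refine ⟨t ∘ f, ?_, fun e => ?_⟩
  · refine D.pullback f (fun _ _ _ _ => f.le_iff_le) (fun _ _ => trivial) id strictMono_id id
      Function.injective_id (fun _ => rfl) (fun _ => rfl) (fun p _ => by simp) fun v => ?_
    exact ⟨f.symm (D.vert v), trivial, by simp [D.label_vert]⟩
  · rw [← hl e, ← Set.ncard_image_of_injective _ f.injective]
    congr 1
    ext p
    constructor
    · rintro ⟨q, hq, rfl⟩; exact hq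
    · intro hp; exact ⟨f.symm p, by simpa using hp, by simp⟩

theorem Shape.HasSizes.nonempty_orderIso {P Q : Type*} [PartialOrder P] [PartialOrder Q]
    [Finite P] [Finite Q] (h : G.HasSizes l P) (h' : G.HasSizes l Q) : Nonempty (P ≃o Q) := by
  obtain ⟨t, D, hl⟩ := h
  obtain ⟨t', D', hl'⟩ := h'
  obtain ⟨f⟩ := D.nonempty_orderIso D' fun e => by simp [hl, hl']
  exact ⟨OrderIso.Set.univ.symm.trans (f.trans OrderIso.Set.univ)⟩

/-- Used for the exchange of two parallel edges; for an involution no inverse is needed to express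
the new sizes. -/
theorem Shape.HasSizes.relabel {P : Type*} [PartialOrder P] (h : G.HasSizes l P) (σ : E → E)
    (hσ : Function.Involutive σ) (hs : ∀ e, G.src (σ e) = G.src e)
    (ht : ∀ e, G.tgt (σ e) = G.tgt e) : G.HasSizes (l ∘ σ) P := by
  obtain ⟨t, D, hl⟩ := h
  refine ⟨Sum.map id σ ∘ t, ?_, fun e => ?_⟩
  · refine D.pullback id (fun _ _ _ _ => Iff.rfl) (fun _ _ => trivial) id strictMono_id σ
      hσ.injective hs ht (fun p _ => ?_) fun v => ?_
    · rcases h : t p with v | e <;> simp [h, hσ _]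
    · exact ⟨D.vert v, trivial, by simp [D.label_vert]⟩
  · rw [Function.comp_apply, ← hl (σ e)]
    congr 1
    ext p
    rcases h : t p with v | f
    · simp [h]
    · simp only [Set.mem_ofPred_eq, Function.comp_apply, h, Sum.map_inr, Sum.inr.injEq]
      exact ⟨fun h => by rw [← h, hσ f], fun h => by rw [h, hσ e]⟩

end HasSizes

/-! ### Isomorphism classes correspond to normalized sizes. -/

namespace Shape.IsConfig

variable {G : Shape (Fin 5) (Fin 7)} (hG : G.IsConfig)

include hG

theorem fullOn_iff {P : Type*} [Finite P] {t : P → Fin 5 ⊕ Fin 7} :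
    G.FullOn Set.univ t ↔ ∀ e, e ≠ 4 → e ≠ 5 → 1 ≤ {p | t p = Sum.inr e}.ncard := by
  refine forall_congr' fun e => ?_
  rw [hG.simple_iff, not_or, and_imp]
  refine imp_congr_right fun _ => imp_congr_right fun _ => ?_
  rw [Nat.one_le_iff_ne_zero, ← Nat.pos_iff_ne_zero, Set.ncard_pos]
  exact ⟨fun ⟨p, _, hp⟩ => ⟨p, hp⟩, fun ⟨p, hp⟩ => ⟨p, trivial, hp⟩⟩

theorem exists_isNormalized {P : Type*} [PartialOrder P] [Finite P] {j : ℕ}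
    (hj : Nat.card P = j) {t : P → Fin 5 ⊕ Fin 7} (D : DecompOn G Set.univ t)
    (hfull : G.FullOn Set.univ t) : ∃ l, IsNormalized j l ∧ G.HasSizes l P := by
  rw [hG.fullOn_iff] at hfull
  have hsum := D.card_eq_sum
  rw [hj, Fintype.card_fin] at hsum
  obtain ⟨l, hl⟩ : ∃ l : Fin 7 → ℕ, ∀ e, {p | t p = Sum.inr e}.ncard = l e := ⟨_, fun _ => rfl⟩
  have hP : G.HasSizes l P := ⟨t, D, hl⟩
  simp only [hl] at hfull hsum
  obtain ⟨l', hP', h01', hfull', hsum'⟩ : ∃ l', G.HasSizes l' P ∧ l' 0 ≤ l' 1 ∧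
      (∀ e, e ≠ 4 → e ≠ 5 → 1 ≤ l' e) ∧ 5 + ∑ e, l' e = j := by
    rcases le_total (l 0) (l 1) with h | h
    · exact ⟨l, hP, h, hfull, hsum.symm⟩
    · refine ⟨l ∘ Equiv.swap 0 1, hP.relabel _ (fun e => by simp)
        ?_ ?_, by simpa using h, fun e he he' => hfull _ ?_ ?_, ?_⟩
      · intro e
        fin_cases e <;> simp [Equiv.swap_apply_def, hG.src_zero]
      · intro e
        fin_cases e <;> simp [Equiv.swap_apply_def, hG.tgt_zero]
      · revert he he'; revert e; decide
      · revert he he'; revert e; decide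
      · rw [hsum]
        simp only [Function.comp_apply]
        rw [Equiv.sum_comp (Equiv.swap (0 : Fin 7) 1) l]
  rcases le_total (l' 2) (l' 3) with h | h
  · exact ⟨l', ⟨hfull' 0 (by decide) (by decide), h01', hfull' 2 (by decide) (by decide), h,
      hfull' 6 (by decide) (by decide), hsum'⟩, hP'⟩
  · refine ⟨l' ∘ Equiv.swap 2 3, ⟨hfull' 0 (by decide) (by decide), h01',
      hfull' 3 (by decide) (by decide), ?_, hfull' 6 (by decide) (by decide), ?_⟩,
      hP'.relabel _ (fun e => by simp) ?_ ?_⟩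
    · simpa using h
    · rw [← hsum']
      simp only [Function.comp_apply]
      rw [Equiv.sum_comp (Equiv.swap (2 : Fin 7) 3) l']
    · intro e
      fin_cases e <;> simp [Equiv.swap_apply_def, hG.src_two]
    · intro e
      fin_cases e <;> simp [Equiv.swap_apply_def, hG.tgt_two]

theorem fullOn_of_isNormalized {P : Type*} [Finite P] {j : ℕ} {l : Fin 7 → ℕ}
    (hl : IsNormalized j l) {t : P → Fin 5 ⊕ Fin 7}
    (ht : ∀ e, {p | t p = Sum.inr e}.ncard = l e) : G.FullOn Set.univ t := by
  rw [hG.fullOn_iff]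
  intro e h4 h5
  rw [ht]
  obtain ⟨h0, h01, h2, h23, h6, -⟩ := hl
  fin_cases e
  · exact h0
  · exact h0.trans h01
  · exact h2
  · exact h2.trans h23
  · exact absurd rfl h4
  · exact absurd rfl h5
  · exact h6

/-- Two decompositions of one lattice share their vertices and, up to an exchange within the two
parallel pairs, their edge chains. An exchange is compatible with both normalizations only if the
two sizes are equal, so the sizes agree anyway. -/
theorem sizes_unique {L : Type*} [Lattice L] [Finite L] {j : ℕ} {l l' : Fin 7 → ℕ}
    (hl : IsNormalized j l) (hl' : IsNormalized j l') (h : G.HasSizes l L)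
    (h' : G.HasSizes l' L) : l = l' := by
  obtain ⟨t, D, ht⟩ := h
  obtain ⟨t', D', ht'⟩ := h'
  have hf := hG.fullOn_of_isNormalized hl ht
  have hv := D.vert_eq D' hf (hG.fullOn_of_isNormalized hl' ht') hG.branched
  have hne : ∀ e, e ≠ 4 → e ≠ 5 → ∃ p, t p = Sum.inr e := fun e h4 h5 => by
    obtain ⟨p, -, hp⟩ := hf e (by rw [hG.simple_iff]; tauto)
    exact ⟨p, hp⟩
  have huniq : ∀ e, e = 4 ∨ e = 5 ∨ e = 6 → l e = l' e := fun e he => by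
    rw [← ht, ← ht', D.fiber_eq_of_unique D' hv]
    intro f hs ht
    have := hG.parallel e f hs ht
    rcases he with rfl | rfl | rfl <;> simpa using this
  obtain ⟨p0, hp0⟩ := hne 0 (by decide) (by decide)
  obtain ⟨p1, hp1⟩ := hne 1 (by decide) (by decide)
  obtain ⟨p2, hp2⟩ := hne 2 (by decide) (by decide)
  obtain ⟨p3, hp3⟩ := hne 3 (by decide) (by decide)
  have h01 : l 0 = l' 0 ∧ l 1 = l' 1 := by
    have key := D.fiber_eq_or_swap D' hv (a := 0) (b := 1) (by decide)
      (fun f hs ht => by simpa using hG.parallel 0 f hs ht)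
      (fun f hs ht => by simpa [or_comm] using hG.parallel 1 f hs ht) hp0 hp1
    have h1 := hl.zero_le_one
    have h2 := hl'.zero_le_one
    rcases key with ⟨ha, hb⟩ | ⟨ha, hb⟩ <;>
    · have ha := congrArg Set.ncard ha
      have hb := congrArg Set.ncard hb
      rw [ht, ht'] at ha hb
      omega
  have h23 : l 2 = l' 2 ∧ l 3 = l' 3 := by
    have key := D.fiber_eq_or_swap D' hv (a := 2) (b := 3) (by decide)
      (fun f hs ht => by simpa using hG.parallel 2 f hs ht)
      (fun f hs ht => by simpa [or_comm] using hG.parallel 3 f hs ht) hp2 hp3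
    have h1 := hl.two_le_three
    have h2 := hl'.two_le_three
    rcases key with ⟨ha, hb⟩ | ⟨ha, hb⟩ <;>
    · have ha := congrArg Set.ncard ha
      have hb := congrArg Set.ncard hb
      rw [ht, ht'] at ha hb
      omega
  funext e
  fin_cases e
  · exact h01.1
  · exact h01.2
  · exact h23.1
  · exact h23.2
  · exact huniq 4 (by simp)
  · exact huniq 5 (by simp)
  · exact huniq 6 (by simp)

variable {B : Type*} [PartialOrder B] {tB : B → Fin 5 ⊕ Fin 7}

/-- A block whose basic block has a minimal decomposition has a full decomposition. -/
theorem exists_decompOn (DB : DecompOn G Set.univ tB) (hB : G.MinimalOn Set.univ tB) {j : ℕ}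
    {L : Type*} [Lattice L] (hL : IsBlockOfType j 5 3 B L) :
    ∃ t : L → Fin 5 ⊕ Fin 7, DecompOn G Set.univ t ∧ G.FullOn Set.univ t := by
  obtain ⟨hL, S, hS, ⟨f⟩⟩ := hL
  have := hL.finite
  exact hL.block.exists_decompOn hG.covers 0 DB hB.1 hS f

theorem isBlockOfType [Finite B] (DB : DecompOn G Set.univ tB) (hB : G.MinimalOn Set.univ tB)
    {j : ℕ} {L : Type*} [Lattice L] [Finite L] (hj : Nat.card L = j) {t : L → Fin 5 ⊕ Fin 7}
    (D : DecompOn G Set.univ t) (hfull : G.FullOn Set.univ t) : IsBlockOfType j 5 3 B L := by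
  have hL : IsBlockOf j 5 3 L := D.isBlockOf hfull hG.branched hG.covers hj (by simp) (by simp)
  obtain ⟨R, hR, DR, hm⟩ := D.exists_isBasicBlockOf hfull hG.branched hL.block
  obtain ⟨f⟩ := DR.nonempty_orderIso_of_minimalOn hm DB hB
  exact ⟨hL, R, hR, ⟨f.trans OrderIso.Set.univ⟩⟩

/-- The normalized sizes are a complete invariant: well defined by `sizes_unique`, injective because
sizes determine the poset, and surjective because each model is a lattice in the class. -/
theorem numBlocksOfType_eq [Finite B] (DB : DecompOn G Set.univ tB)
    (hB : G.MinimalOn Set.univ tB) {j : ℕ} (hj : 10 ≤ j) :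
    numBlocksOfType j 5 3 B = blockSum j := by
  rw [← card_isNormalized hj, numBlocksOfType]
  have hex : ∀ L : {L : Lattice (Fin j) // @IsBlockOfType j 5 3 B _ (Fin j) L},
      ∃ l : {l // IsNormalized j l}, @Shape.HasSizes _ _ _ G l (Fin j) L.1.toPartialOrder := by
    rintro ⟨L, hL⟩
    obtain ⟨t, D, hfull⟩ := @exists_decompOn G hG B _ tB DB hB j (Fin j) L hL
    obtain ⟨l, hl, h⟩ := @exists_isNormalized G hG (Fin j) L.toPartialOrder _ j (by simp) t D hfull
    exact ⟨⟨l, hl⟩, h⟩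
  choose F hF using hex
  refine Nat.card_congr (Equiv.ofBijective (Quotient.lift F ?_) ⟨?_, ?_⟩)
  · rintro L M ⟨f⟩
    apply Subtype.ext
    refine @sizes_unique G hG (Fin j) L.1 _ j _ _ (F L).2 (F M).2 (hF L) ?_
    exact @Shape.HasSizes.of_orderIso _ _ _ G _ (Fin j) (Fin j) M.1.toPartialOrder
      L.1.toPartialOrder (hF M) f
  · intro x y
    induction x, y using Quotient.inductionOn₂ with
    | _ L M =>
    intro h
    replace h : F L = F M := h
    apply Quotient.sound
    exact @Shape.HasSizes.nonempty_orderIso _ _ _ G (F L) (Fin j) (Fin j) L.1.toPartialOrder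
      M.1.toPartialOrder _ _ (hF L) (h ▸ hF M)
  · rintro ⟨l, hl⟩
    have hM : Nat.card (G.Model l) = j := by
      have : Finite (G.Model l) := inferInstanceAs (Finite (_ ⊕ _))
      rw [(Shape.Model.decompOn G l).card_eq_sum, ← hl.sum_eq]
      simp [Shape.Model.ncard_label]
    have : Finite (G.Model l) := inferInstanceAs (Finite (_ ⊕ _))
    -- The count is over structures on `Fin j`, so the model is transported there along a bijection.
    obtain ⟨L, t, D, ht⟩ := Shape.exists_lattice G l
      ((Finite.equivFinOfCardEq hM).symm)
    have hfull := hG.fullOn_of_isNormalized hl ht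
    have hL := @isBlockOfType G hG B _ tB _ DB hB j (Fin j) L _ (by simp) t D hfull
    refine ⟨Quotient.mk _ ⟨L, hL⟩, Subtype.ext ?_⟩
    exact @sizes_unique G hG (Fin j) L _ j _ _ (F ⟨L, hL⟩).2 hl (hF ⟨L, hL⟩) ⟨t, D, ht⟩

end Shape.IsConfig

end RCLattices

namespace RCLattices

/-! ### Decidability -/

instance Shape.decidableSimple {n : ℕ} {E : Type*} [Fintype E] [DecidableEq E]
    (G : Shape (Fin n) E) : DecidablePred G.Simple := fun e =>
  inferInstanceAs (Decidable ((G.src e < G.tgt e ∧ ∀ c, G.src e < c → ¬ c < G.tgt e) ∧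
    ∀ f, G.src f = G.src e → G.tgt f = G.tgt e → f = e))

instance Shape.decidableLe {n : ℕ} {E : Type*} (G : Shape (Fin n) E) :
    DecidableRel G.le
  | Sum.inl u, Sum.inl v => inferInstanceAs (Decidable (u ≤ v))
  | Sum.inl u, Sum.inr e => inferInstanceAs (Decidable (u ≤ G.src e))
  | Sum.inr e, Sum.inl v => inferInstanceAs (Decidable (G.tgt e ≤ v))
  | Sum.inr e, Sum.inr f => inferInstanceAs (Decidable (G.tgt e ≤ G.src f))

instance Shape.decidableBranched {n : ℕ} {E : Type*} [Fintype E] [DecidableEq E]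
    (G : Shape (Fin n) E) : Decidable G.Branched :=
  inferInstanceAs (Decidable (∀ v, ∃ e, ¬ G.Simple e ∧ (G.src e = v ∨ G.tgt e = v)))

theorem exists_edge_of_covBy {n : ℕ} {E : Type*} {G : Shape (Fin n) E}
    (h : ∀ u v : Fin n, (u : ℕ) + 1 = v → ∃ e, G.src e = u ∧ G.tgt e = v) (u v : Fin n)
    (huv : u ⋖ v) : ∃ e, G.src e = u ∧ G.tgt e = v := by
  refine h u v ?_
  by_contra hne
  have h1 : (u : ℕ) < v := huv.lt
  exact huv.2 (c := ⟨u + 1, by omega⟩) (Fin.lt_def.2 (by simp))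
    (Fin.lt_def.2 (by simp; omega))

namespace Adjunct

variable {α β : Type*} [PartialOrder α] [PartialOrder β] {a b : α}

instance [Fintype α] [Fintype β] (h : a < b) : Fintype (Adjunct α β h) :=
  inferInstanceAs (Fintype (α ⊕ β))

instance [DecidableEq α] [DecidableEq β] (h : a < b) : DecidableEq (Adjunct α β h) :=
  inferInstanceAs (DecidableEq (α ⊕ β))

instance decidableLE [DecidableLE α] [DecidableLE β] (h : a < b) : DecidableLE (Adjunct α β h)
  | Sum.inl x, Sum.inl y => inferInstanceAs (Decidable (x ≤ y))
  | Sum.inl x, Sum.inr _ => inferInstanceAs (Decidable (x ≤ a))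
  | Sum.inr _, Sum.inl y => inferInstanceAs (Decidable (b ≤ y))
  | Sum.inr u, Sum.inr v => inferInstanceAs (Decidable (u ≤ v))

end Adjunct

/-! ### The shapes of the four basic blocks -/

/-- A labelling of a threefold adjunct of a chain. -/
def chainLabel {n : ℕ} {a₁ b₁ a₂ b₂ a₃ b₃ : Fin n} {h₁ : a₁ < b₁} {h₂ : a₂ < b₂}
    {h₃ : a₃ < b₃} {X : Type*} (f : Fin n → X) (x₁ x₂ x₃ : X) : ChainAdjunct n h₁ h₂ h₃ → X :=
  Sum.elim (Sum.elim (Sum.elim f fun _ => x₁) fun _ => x₂) fun _ => x₃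

/-- When labels are injective all conditions become finite checks. Equality has to be allowed
separately in `h2`, since the shape's relation is not reflexive on edges. -/
theorem decompOn_and_minimalOn {P V E : Type*} [PartialOrder P] [LinearOrder V] {G : Shape V E}
    {t : P → V ⊕ E} (h1 : ∀ v, ∃ p, t p = Sum.inl v)
    (h2 : ∀ p q, p ≤ q ↔ p = q ∨ G.le (t p) (t q))
    (h3 : ∀ e, ¬ G.Simple e → ∃ p, t p = Sum.inr e)
    (h4 : ∀ p e, t p = Sum.inr e → ¬ G.Simple e)
    (h5 : ∀ p q, t p = t q → p = q) :
    DecompOn G Set.univ t ∧ G.MinimalOn Set.univ t := by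
  refine ⟨⟨fun v => ?_, fun p _ q _ h => ?_, fun p _ q _ e hp hq => ?_⟩, fun e he => ?_,
    fun p _ q _ e hp hq => ⟨h5 p q (hp.trans hq.symm), h4 p e hp⟩⟩
  · obtain ⟨p, hp⟩ := h1 v
    exact ⟨p, trivial, hp⟩
  · rw [h2]
    refine or_iff_right_of_imp ?_
    rintro rfl
    rcases hp : t p with v | e
    · exact le_refl v
    · exact absurd hp (h e hp)
  · exact Or.inl (h5 p q (hp.trans hq.symm)).le
  · obtain ⟨p, hp⟩ := h3 e he
    exact ⟨p, trivial, hp⟩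

/-- The shape of `B₂₀`. -/
def shape20 : Shape (Fin 5) (Fin 7) :=
  ⟨![0, 0, 2, 2, 1, 3, 2], ![1, 1, 3, 3, 2, 4, 4], by decide⟩

/-- The shape of `B₂₁`. -/
def shape21 : Shape (Fin 5) (Fin 7) :=
  ⟨![1, 1, 3, 3, 0, 2, 0], ![2, 2, 4, 4, 1, 3, 2], by decide⟩

/-- The shape of `B₂₂`. -/
def shape22 : Shape (Fin 5) (Fin 7) :=
  ⟨![0, 0, 3, 3, 1, 2, 2], ![1, 1, 4, 4, 2, 3, 4], by decide⟩

/-- The shape of `B₂₃`. -/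
def shape23 : Shape (Fin 5) (Fin 7) :=
  ⟨![0, 0, 3, 3, 1, 2, 0], ![1, 1, 4, 4, 2, 3, 2], by decide⟩

theorem isConfig_shape20 : shape20.IsConfig where
  simple_iff := by decide
  branched := by decide
  covers := exists_edge_of_covBy (by decide)
  parallel := by decide
  src_zero := rfl
  tgt_zero := rfl
  src_two := rfl
  tgt_two := rfl

theorem isConfig_shape21 : shape21.IsConfig where
  simple_iff := by decide
  branched := by decide
  covers := exists_edge_of_covBy (by decide)
  parallel := by decide
  src_zero := rfl
  tgt_zero := rfl
  src_two := rfl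
  tgt_two := rfl

theorem isConfig_shape22 : shape22.IsConfig where
  simple_iff := by decide
  branched := by decide
  covers := exists_edge_of_covBy (by decide)
  parallel := by decide
  src_zero := rfl
  tgt_zero := rfl
  src_two := rfl
  tgt_two := rfl

theorem isConfig_shape23 : shape23.IsConfig where
  simple_iff := by decide
  branched := by decide
  covers := exists_edge_of_covBy (by decide)
  parallel := by decide
  src_zero := rfl
  tgt_zero := rfl
  src_two := rfl
  tgt_two := rfl

/-- The labelling of `B₂₀`. -/
def label20 : B20 → Fin 5 ⊕ Fin 7 :=
  chainLabel ![.inl 0, .inr 0, .inl 1, .inl 2, .inr 2, .inl 3, .inl 4] (.inr 1) (.inr 3) (.inr 6)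

/-- The labelling of `B₂₁`. -/
def label21 : B21 → Fin 5 ⊕ Fin 7 :=
  chainLabel ![.inl 0, .inl 1, .inr 0, .inl 2, .inl 3, .inr 2, .inl 4] (.inr 1) (.inr 6) (.inr 3)

/-- The labelling of `B₂₂`. -/
def label22 : B22 → Fin 5 ⊕ Fin 7 :=
  chainLabel ![.inl 0, .inr 0, .inl 1, .inl 2, .inl 3, .inr 2, .inl 4] (.inr 1) (.inr 6) (.inr 3)

/-- The labelling of `B₂₃`. -/
def label23 : B23 → Fin 5 ⊕ Fin 7 :=
  chainLabel ![.inl 0, .inr 0, .inl 1, .inl 2, .inl 3, .inr 2, .inl 4] (.inr 1) (.inr 6) (.inr 3)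

theorem decomp_B20 : DecompOn shape20 Set.univ label20 ∧ shape20.MinimalOn Set.univ label20 :=
  decompOn_and_minimalOn (by decide +kernel) (by decide +kernel) (by decide +kernel)
    (by decide +kernel) (by decide +kernel)

theorem decomp_B21 : DecompOn shape21 Set.univ label21 ∧ shape21.MinimalOn Set.univ label21 :=
  decompOn_and_minimalOn (by decide +kernel) (by decide +kernel) (by decide +kernel)
    (by decide +kernel) (by decide +kernel)

theorem decomp_B22 : DecompOn shape22 Set.univ label22 ∧ shape22.MinimalOn Set.univ label22 :=
  decompOn_and_minimalOn (by decide +kernel) (by decide +kernel) (by decide +kernel)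
    (by decide +kernel) (by decide +kernel)

theorem decomp_B23 : DecompOn shape23 Set.univ label23 ∧ shape23.MinimalOn Set.univ label23 :=
  decompOn_and_minimalOn (by decide +kernel) (by decide +kernel) (by decide +kernel)
    (by decide +kernel) (by decide +kernel)

end RCLattices

namespace RCLattices

/-! ### Intervals of decomposed lattices -/

section Interval

variable {P V E V' E' : Type*} [PartialOrder P] [LinearOrder V] [LinearOrder V'] {G : Shape V E}
  {G' : Shape V' E'} {t : P → V ⊕ E}

/-- The decomposition induced on an order convex set. -/
theorem DecompOn.exists_restrict (D : DecompOn G Set.univ t) (hfull : G.FullOn Set.univ t)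
    (S : Set P) [S.OrdConnected] (φ : V' → V) (hφ : StrictMono φ) (ψ : E' → E)
    (hψ : Function.Injective ψ) (hsrc : ∀ e, G.src (ψ e) = φ (G'.src e))
    (htgt : ∀ e, G.tgt (ψ e) = φ (G'.tgt e)) (hS : ∀ p ∈ S, ∃ x, t p = Sum.map φ ψ x)
    (hv : ∀ v, D.vert (φ v) ∈ S) (hsimple : ∀ e, ¬ G'.Simple e → ¬ G.Simple (ψ e)) :
    ∃ t' : S → V' ⊕ E', DecompOn G' Set.univ t' ∧ G'.FullOn Set.univ t' := by
  choose t' ht' using fun p : S => hS p p.2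
  have hinj : Function.Injective (Sum.map φ ψ) := hφ.injective.sumMap hψ
  refine ⟨t', ?_, fun e he => ?_⟩
  · refine D.pullback Subtype.val (fun _ _ _ _ => Iff.rfl) (fun _ _ => trivial) φ hφ ψ hψ hsrc htgt
      (fun p _ => ht' p) fun v => ⟨⟨_, hv v⟩, trivial, hinj ?_⟩
    rw [← ht', D.label_vert]; rfl
  · obtain ⟨p, -, hp⟩ := hfull _ (hsimple e he)
    have h1 := D.src_lt trivial hp
    have h2 := D.lt_tgt trivial hp
    rw [hsrc] at h1
    rw [htgt] at h2
    have hpS : p ∈ S := Set.OrdConnected.out ‹_› (hv _) (hv _) ⟨h1.le, h2.le⟩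
    refine ⟨⟨p, hpS⟩, trivial, hinj ?_⟩
    rw [← ht', hp]; rfl

end Interval

/-! ### Heights of basic blocks and the two smaller shapes. -/

theorem krullDim_eq_of_strictMono {P : Type*} [PartialOrder P] {h : ℕ} {f : P → Fin (h + 1)}
    (hf : StrictMono f) {g : Fin (h + 1) → P} (hg : StrictMono g) :
    Order.krullDim P = (h : ℕ) := by
  apply le_antisymm
  · refine (Order.krullDim_le_of_strictMono f hf).trans (iSup_le fun s => ?_)
    have := s.length_lt_card
    rw [Fintype.card_fin] at this
    exact_mod_cast Nat.lt_succ_iff.1 this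
  · exact le_iSup (fun s : LTSeries P => (s.length : WithBot ℕ∞)) (LTSeries.mk h g hg)

/-- The height of a minimally decomposed set, from a rank function on the labels and a chain of
labels. -/
theorem DecompOn.krullDim_eq {P V E : Type*} [PartialOrder P] [LinearOrder V] {G : Shape V E}
    {S : Set P} {t : P → V ⊕ E} (D : DecompOn G S t) (hm : G.MinimalOn S t) {h : ℕ}
    (ρ : V ⊕ E → Fin (h + 1))
    (hρ : ∀ a b, (∀ e, G.Simple e → a ≠ Sum.inr e) → (∀ e, G.Simple e → b ≠ Sum.inr e) →
      G.le a b → a ≠ b → ρ a < ρ b)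
    (c : Fin (h + 1) → V ⊕ E) (hc : ∀ i e, c i = Sum.inr e → ¬ G.Simple e)
    (hc' : ∀ i k, i < k → c i ≠ c k ∧ G.le (c i) (c k)) : Order.krullDim S = (h : ℕ) := by
  have hns : ∀ p ∈ S, ∀ e, G.Simple e → t p ≠ Sum.inr e := fun p hp e he hpe =>
    (hm.2 p hp p hp e hpe hpe).2 he
  have hex : ∀ i, ∃ p : S, t p = c i := fun i => by
    rcases h : c i with v | e
    · exact ⟨⟨_, D.vert_mem v⟩, D.label_vert v⟩
    · obtain ⟨p, hp, hpe⟩ := hm.1 e (hc i e h)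
      exact ⟨⟨p, hp⟩, hpe⟩
  choose g hg using hex
  refine krullDim_eq_of_strictMono (f := fun p => ρ (t p)) ?_ (g := g) ?_
  · intro p q hpq
    have hpq' : (p : P) < q := hpq
    have hne : t p ≠ t q := by
      intro heq
      rcases hq : t q with v | e
      · rw [hq] at heq
        exact hpq'.ne ((D.eq_vert p.2 heq).trans (D.eq_vert q.2 hq).symm)
      · rw [hq] at heq
        exact hpq'.ne (hm.2 p p.2 q q.2 e heq hq).1
    exact hρ _ _ (hns p p.2) (hns q q.2) ((D.le_iff p p.2 q q.2
      fun e he he' => hne (he.trans he'.symm)).1 hpq'.le) hne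
  · intro i k hik
    obtain ⟨h1, h2⟩ := hc' i k hik
    have hle : (g i : P) ≤ g k := by
      rw [D.le_iff _ (g i).2 _ (g k).2, hg, hg]
      · exact h2
      · intro e he he'
        rw [hg] at he he'
        exact h1 (he.trans he'.symm)
    refine lt_of_le_of_ne hle fun heq => h1 ?_
    rw [← hg, ← hg, heq]

/-- The shape of a block with two reducible elements and nullity one. -/
def shapeLower : Shape (Fin 2) (Fin 2) := ⟨![0, 0], ![1, 1], by decide⟩

/-- The shape of the upper part of `B₂₀`. -/
def shapeUpper : Shape (Fin 3) (Fin 4) := ⟨![0, 0, 1, 0], ![1, 1, 2, 2], by decide⟩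

theorem one_le_ncard_of_fullOn {P V E : Type*} [Finite P] [LinearOrder V] {G : Shape V E}
    {t : P → V ⊕ E} (hfull : G.FullOn Set.univ t) {e : E} (he : ¬ G.Simple e) :
    1 ≤ {p | t p = Sum.inr e}.ncard := by
  obtain ⟨p, -, hp⟩ := hfull e he
  exact (Set.ncard_pos).2 ⟨p, hp⟩

theorem isBlockOfHeight_of_shapeLower {L : Type*} [Lattice L] [Finite L] {t : L → Fin 2 ⊕ Fin 2}
    (D : DecompOn shapeLower Set.univ t) (hfull : shapeLower.FullOn Set.univ t) :
    4 ≤ Nat.card L ∧ IsBlockOfHeight (Nat.card L) 2 1 2 L := by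
  have hb : shapeLower.Branched := by decide
  have hL : IsBlockOf (Nat.card L) 2 1 L :=
    D.isBlockOf hfull hb (exists_edge_of_covBy (by decide)) rfl (by simp) (by simp)
  obtain ⟨R, hR, DR, hm⟩ := D.exists_isBasicBlockOf hfull hb hL.block
  refine ⟨?_, hL, R, hR, DR.krullDim_eq hm (Sum.elim ![0, 2] ![1, 1]) ?_
    ![.inl 0, .inr 0, .inl 1] (by decide) (by decide)⟩
  · rw [D.card_eq_sum, Fin.sum_univ_two, Fintype.card_fin]
    have h0 := one_le_ncard_of_fullOn hfull (e := 0) (by decide)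
    have h1 := one_le_ncard_of_fullOn hfull (e := 1) (by decide)
    omega
  · decide +kernel

theorem isBlockOfHeight_of_shapeUpper {L : Type*} [Lattice L] [Finite L] {t : L → Fin 3 ⊕ Fin 4}
    (D : DecompOn shapeUpper Set.univ t) (hfull : shapeUpper.FullOn Set.univ t) :
    6 ≤ Nat.card L ∧ IsBlockOfHeight (Nat.card L) 3 2 3 L := by
  have hb : shapeUpper.Branched := by decide
  have hL : IsBlockOf (Nat.card L) 3 2 L :=
    D.isBlockOf hfull hb (exists_edge_of_covBy (by decide)) rfl (by simp) (by simp)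
  obtain ⟨R, hR, DR, hm⟩ := D.exists_isBasicBlockOf hfull hb hL.block
  -- Vertices have ranks 0, 2, 3 and points of non-simple edges rank 1. The rank 0 of edge 2 is
  -- arbitrary: that edge is simple and carries no point of the minimal decomposition.
  refine ⟨?_, hL, R, hR, DR.krullDim_eq hm (Sum.elim ![0, 2, 3] ![1, 1, 0, 1]) ?_
    ![.inl 0, .inr 0, .inl 1, .inl 2] (by decide) (by decide)⟩
  · rw [D.card_eq_sum, Fin.sum_univ_four, Fintype.card_fin]
    have h0 := one_le_ncard_of_fullOn hfull (e := 0) (by decide)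
    have h1 := one_le_ncard_of_fullOn hfull (e := 1) (by decide)
    have h3 := one_le_ncard_of_fullOn hfull (e := 3) (by decide)
    omega
  · intro a b ha hb
    replace ha := ha 2 (by decide)
    replace hb := hb 2 (by decide)
    revert a b
    decide +kernel

/-- A bounded poset is the linear sum of the intervals cut out by two comparable elements that
are comparable to everything. -/
theorem exists_linearSum {L : Type*} [PartialOrder L] [BoundedOrder L] {a b : L} (hab : a < b)
    (h : ∀ p : L, p ≤ a ∨ p ∈ Set.Ioo a b ∨ b ≤ p) :
    ∃ e : Lex (Lex (Set.Icc (⊥ : L) a ⊕ Set.Ioo a b) ⊕ Set.Icc b (⊤ : L)) ≃o L,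
      (∀ x, e (Sum.inlₗ (Sum.inlₗ x)) = x) ∧ (∀ x, e (Sum.inlₗ (Sum.inrₗ x)) = x) ∧
      (∀ x, e (Sum.inrₗ x) = x) := by
  let f : Lex (Lex (Set.Icc (⊥ : L) a ⊕ Set.Ioo a b) ⊕ Set.Icc b (⊤ : L)) → L := fun x =>
    Sum.elim (fun y => Sum.elim Subtype.val Subtype.val (ofLex y)) Subtype.val (ofLex x)
  have hf : ∀ x y, f x ≤ f y ↔ x ≤ y := by
    rintro ((x | x) | x) ((y | y) | y)
    · exact ((Sum.Lex.inl_le_inl_iff (a := toLex (Sum.inl x)) (b := toLex (Sum.inl y))).trans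
        (Sum.Lex.inl_le_inl_iff (a := x) (b := y))).symm
    · exact iff_of_true (x.2.2.trans y.2.1.le)
        (Sum.Lex.inl_le_inl_iff.2 (Sum.Lex.inl_le_inr x y))
    · exact iff_of_true (x.2.2.trans (hab.le.trans y.2.1)) (Sum.Lex.inl_le_inr _ y)
    · exact iff_of_false (y.2.2.trans_lt x.2.1).not_ge
        fun h => Sum.Lex.not_inr_le_inl (Sum.Lex.inl_le_inl_iff.1 h)
    · exact ((Sum.Lex.inl_le_inl_iff (a := toLex (Sum.inr x)) (b := toLex (Sum.inr y))).trans
        (Sum.Lex.inr_le_inr_iff (a := x) (b := y))).symm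
    · exact iff_of_true (x.2.2.le.trans y.2.1) (Sum.Lex.inl_le_inr _ y)
    · exact iff_of_false (y.2.2.trans_lt (hab.trans_le x.2.1)).not_ge Sum.Lex.not_inr_le_inl
    · exact iff_of_false (y.2.2.trans_le x.2.1).not_ge Sum.Lex.not_inr_le_inl
    · exact (Sum.Lex.inr_le_inr_iff (a := x) (b := y)).symm
  have hinj : Function.Injective f := fun x y h =>
    le_antisymm ((hf x y).1 h.le) ((hf y x).1 h.ge)
  have hsurj : Function.Surjective f := fun p => by
    rcases h p with hp | hp | hp
    · exact ⟨Sum.inlₗ (Sum.inlₗ ⟨p, bot_le, hp⟩), rfl⟩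
    · exact ⟨Sum.inlₗ (Sum.inrₗ ⟨p, hp⟩), rfl⟩
    · exact ⟨Sum.inrₗ ⟨p, hp, le_top⟩, rfl⟩
  exact ⟨⟨Equiv.ofBijective f ⟨hinj, hsurj⟩, fun {x y} => hf x y⟩, fun _ => rfl, fun _ => rfl,
    fun _ => rfl⟩

/-- The members of the class of `B₂₀` are linear sums. -/
theorem exists_linearSum_of_B20 {j : ℕ} (L : Type*) [Lattice L] [BoundedOrder L]
    (hL : IsBlockOfType j 5 3 B20 L) :
    ∃ a b c : L, ⊥ < a ∧ a < b ∧ b < c ∧ c < ⊤ ∧ Red L = {⊥, a, b, c, ⊤} ∧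
      ∃ p q r : ℕ, 4 ≤ p ∧ 6 ≤ q ∧ p + q + r = j ∧
        IsBlockOfHeight p 2 1 2 (Set.Icc (⊥ : L) a) ∧
        IsBlockOfHeight q 3 2 3 (Set.Icc b (⊤ : L)) ∧
        IsChain (· ≤ ·) (Set.Ioo a b) ∧ (Set.Ioo a b).ncard = r ∧
        ∃ e : Lex (Lex (Set.Icc (⊥ : L) a ⊕ Set.Ioo a b) ⊕ Set.Icc b (⊤ : L)) ≃o L,
          (∀ x, e (Sum.inlₗ (Sum.inlₗ x)) = x) ∧
          (∀ x, e (Sum.inlₗ (Sum.inrₗ x)) = x) ∧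
          (∀ x, e (Sum.inrₗ x) = x) := by
  have := hL.1.finite
  obtain ⟨t, D, hfull⟩ := isConfig_shape20.exists_decompOn decomp_B20.1 decomp_B20.2 hL
  have hbot : D.vert 0 = ⊥ := (D.isBot_vert (v := 0) fun v => Fin.zero_le v).eq_bot
  have htop : D.vert 4 = ⊤ := (D.isTop_vert (v := 4) fun v => Fin.le_last v).eq_top
  have hlt : ∀ {u v : Fin 5}, u < v → D.vert u < D.vert v := D.vert_lt_vert.2
  -- labels of the points of the three parts
  have hlow : ∀ p, p ≤ D.vert 1 ↔ shape20.le (t p) (Sum.inl 1) := fun p => by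
    rcases h : t p with v | e
    · rw [D.eq_vert trivial h, D.vert_le_vert]; rfl
    · rw [D.edge_le_vert trivial h]; rfl
  have hup : ∀ p, D.vert 2 ≤ p ↔ shape20.le (Sum.inl 2) (t p) := fun p => by
    rcases h : t p with v | e
    · rw [D.eq_vert trivial h, D.vert_le_vert]; rfl
    · rw [D.vert_le_edge trivial h]; rfl
  -- No edge other than 4 meets the gap between the vertices 1 and 2; this is a finite check on
  -- labels.
  have hmid : ∀ p, ¬ p ≤ D.vert 1 → ¬ D.vert 2 ≤ p → t p = Sum.inr 4 := fun p => by
    rw [hlow, hup]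
    generalize t p = x
    revert x
    decide
  have hcut : ∀ p, p ≤ D.vert 1 ∨ p ∈ Set.Ioo (D.vert 1) (D.vert 2) ∨ D.vert 2 ≤ p := fun p => by
    by_cases h1 : p ≤ D.vert 1
    · exact Or.inl h1
    · by_cases h2 : D.vert 2 ≤ p
      · exact Or.inr (Or.inr h2)
      · have := hmid p h1 h2
        exact Or.inr (Or.inl ⟨D.src_lt trivial this, D.lt_tgt trivial this⟩)
  -- Below vertex 1 only the first parallel pair of edges survives.
  obtain ⟨t₁, D₁, hfull₁⟩ := D.exists_restrict (G' := shapeLower) hfull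
    (Set.Icc (⊥ : L) (D.vert 1)) ![0, 1] (by decide) ![0, 1] (by decide) (by decide) (by decide)
    (fun p hp => by
      have := (hlow p).1 hp.2
      revert this
      generalize t p = x
      revert x
      decide)
    (fun v => ⟨bot_le, D.vert_le_vert.2 (by revert v; decide)⟩) (by decide)
  -- Above vertex 2 lie the second parallel pair, the simple edge 5 and the edge 6 skipping vertex
  -- 3; in `shapeUpper` the last two become the edges 2 and 3.
  obtain ⟨t₂, D₂, hfull₂⟩ := D.exists_restrict (G' := shapeUpper) hfull
    (Set.Icc (D.vert 2) (⊤ : L)) ![2, 3, 4] (by decide) ![2, 3, 5, 6] (by decide) (by decide)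
    (by decide)
    (fun p hp => by
      have := (hup p).1 hp.1
      revert this
      generalize t p = x
      revert x
      decide)
    (fun v => ⟨D.vert_le_vert.2 (by revert v; decide), le_top⟩) (by decide)
  obtain ⟨hp, hp'⟩ := isBlockOfHeight_of_shapeLower D₁ hfull₁
  obtain ⟨hq, hq'⟩ := isBlockOfHeight_of_shapeUpper D₂ hfull₂
  obtain ⟨e, he⟩ := exists_linearSum (hlt (u := 1) (v := 2) (by decide)) hcut
  refine ⟨D.vert 1, D.vert 2, D.vert 3, hbot ▸ hlt (by decide), hlt (by decide), hlt (by decide),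
    htop ▸ hlt (by decide), ?_, _, _, _, hp, hq, ?_, hp', hq', ?_, rfl, e, he⟩
  · rw [D.red_eq hfull isConfig_shape20.branched, ← hbot, ← htop]
    ext p
    simp only [Set.mem_range, Fin.exists_fin_succ, Set.mem_insert_iff, Set.mem_singleton_iff]
    simp [eq_comm]
  · have : Finite (Lex (Set.Icc (⊥ : L) (D.vert 1) ⊕ Set.Ioo (D.vert 1) (D.vert 2))) :=
      inferInstanceAs (Finite (_ ⊕ _))
    rw [← hL.1.card_eq, ← Nat.card_congr e.toEquiv, Nat.card_congr ofLex, Nat.card_sum,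
      Nat.card_congr ofLex, Nat.card_sum, ← Nat.card_coe_set_eq]
    ring
  · intro p hp q hq _
    have key : ∀ p ∈ Set.Ioo (D.vert 1) (D.vert 2), t p = Sum.inr 4 := fun p hp =>
      hmid p hp.1.not_ge hp.2.not_ge
    exact D.total p trivial q trivial 4 (key p hp) (key q hq)

end RCLattices

theorem mainTheorem10 (j : ℕ) (hj : 10 ≤ j) :
    numBlocksOfType j 5 3 B20 = blockSum j ∧
    (∀ (L : Type*) [Lattice L] [BoundedOrder L], IsBlockOfType j 5 3 B20 L →
      ∃ a b c : L, ⊥ < a ∧ a < b ∧ b < c ∧ c < ⊤ ∧ Red L = {⊥, a, b, c, ⊤} ∧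
        ∃ p q r : ℕ, 4 ≤ p ∧ 6 ≤ q ∧ p + q + r = j ∧
          IsBlockOfHeight p 2 1 2 (Set.Icc (⊥ : L) a) ∧
          IsBlockOfHeight q 3 2 3 (Set.Icc b (⊤ : L)) ∧
          IsChain (· ≤ ·) (Set.Ioo a b) ∧ (Set.Ioo a b).ncard = r ∧
          ∃ e : Lex (Lex (Set.Icc (⊥ : L) a ⊕ Set.Ioo a b) ⊕ Set.Icc b (⊤ : L)) ≃o L,
            (∀ x, e (Sum.inlₗ (Sum.inlₗ x)) = x) ∧
            (∀ x, e (Sum.inlₗ (Sum.inrₗ x)) = x) ∧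
            (∀ x, e (Sum.inrₗ x) = x)) ∧
    numBlocksOfType j 5 3 B21 = blockSum j ∧
    numBlocksOfType j 5 3 B22 = blockSum j ∧
    numBlocksOfType j 5 3 B23 = blockSum j := by
  have h20 : Finite B20 := Finite.of_fintype _
  have h21 : Finite B21 := Finite.of_fintype _
  have h22 : Finite B22 := Finite.of_fintype _
  have h23 : Finite B23 := Finite.of_fintype _
  exact ⟨isConfig_shape20.numBlocksOfType_eq decomp_B20.1 decomp_B20.2 hj,
    fun L _ _ hL => exists_linearSum_of_B20 L hL,
    isConfig_shape21.numBlocksOfType_eq decomp_B21.1 decomp_B21.2 hj,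
    isConfig_shape22.numBlocksOfType_eq decomp_B22.1 decomp_B22.2 hj,
    isConfig_shape23.numBlocksOfType_eq decomp_B23.1 decomp_B23.2 hj⟩
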